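/- **Setting.** Let $\mathcal S=\{1,\dots,D\}$ and let $\Pi=(\pi_{ij})_{i,j\in\mathcal S}$ be an irreducible generator ($\pi_{ij}\ge 0$ for $i\ne j$, $\pi_{ii}=-\sum_{j\neq i}\pi_{ij}$). Let $\alpha=(\alpha_t)_{t\ge0}$ be an $\mathcal S$-valued process with right-continuous paths having left limits and, for each $i\in\mathcal S$, let $\mathbb P_i$ be a probability measure under which $\alpha$ is a Markov chain with generator $\Pi$ and $\alpha_0=i$. Let $\mathbb E_i$ be the expectation under $\mathbb P_i$ and $\mathbb F^i$ the natural filtration of $\alpha$ augmented by the $\mathbb P_i$-null sets. Write $L^2_{\mathbb F}(\mathbb R^k)$ (resp. $L^2_{\mathcal P}(\mathbb R^k)$) for the set of $\mathbb R^k$-valued $\mathbb F^i$-progressively measurable (resp. $\mathbb F^i$-predictable) processes $\varphi$ with $\mathbb E_i\int_0^\infty|\varphi(t)|^2dt<\infty$, processes that agree $dt\otimes d\mathbb P_i$-a.e. being identified; a process not tied to an initial state is said to be in one of these spaces if it is so for every $i\in\mathcal S$. For $i\in\mathcal S$ let $A(i)\in\mathbb R^{n\times n}$, $B(i)\in\mathbb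 R^{n\times m}$, $S(i)\in\mathbb R^{m\times n}$, $Q(i)\in\mathbb R^{n\times n}$ symmetric, $R(i)\in\mathbb R^{m\times m}$ symmetric positive definite with $Q(i)-S(i)^\top R(i)^{-1}S(i)\ge0$; let $b,q\in L^2_{\mathbb F}(\mathbb R^n)$, $\rho\in L^2_{\mathbb F}(\mathbb R^m)$. For $(x,i)\in\mathbb R^n\times\mathcal S$ and $u\in L^2_{\mathcal P}(\mathbb R^m)$, let $X=X(\cdot;x,i,u)$ be the solution of $$\dot X(t)=A(\alpha_t)X(t)+B(\alpha_t)u(t)+b(t),\qquad X(0)=x,\ \alpha_0=i,$$ put $\mathcal U_{LQ}(x,i)=\{u\in L^2_{\mathcal P}(\mathbb R^m): X(\cdot;x,i,u)\in L^2_{\mathbb F}(\mathbb R^n)\}$ and $$J(x,i;u)=\mathbb E_i\int_0^\infty\Big[\Big\langle\begin{pmatrix}Q(\alpha_t)&S(\alpha_t)^\top\\S(\alpha_t)&R(\alpha_t)\end{pmatrix}\begin{pmatrix}X\\u\end{pmatrix},\begin{pmatrix}X\\u\end{pmatrix}\Big\rangle+2\Big\langle\begin{pmatrix}q\\\rho\end{pmatrix},\begin{pmatrix}X\\u\end{pmatrix}\Big\rangle\Big]dt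 .$$ A family $\Theta=(\Theta(i))_{i\in\mathcal S}$ of matrices in $\mathbb R^{m\times n}$ is a *stabilizer*, $\Theta\in\mathcal H_\alpha$, if there are symmetric positive definite $P(i)$, $i\in\mathcal S$, such that $P(i)[A(i)+B(i)\Theta(i)]+[A(i)+B(i)\Theta(i)]^\top P(i)+\sum_j\pi_{ij}P(j)<0$ for all $i$. For $\Theta\in\mathcal H_\alpha$ let $X_\Theta(\cdot;x,i,\nu)$ and $J_\Theta(x,i;\nu)$ be the state and the cost obtained from those above when $A,Q,S,q$ are replaced by $A_\Theta=A+B\Theta$, $Q_\Theta=Q+S^\top\Theta+\Theta^\top S+\Theta^\top R\Theta$, $S_\Theta=S+R\Theta$, $q_\Theta=q+\Theta(\alpha)^\top\rho$, and $u$ by $\nu$. A control $\nu^*\in L^2_{\mathcal P}(\mathbb R^m)$ is an *open-loop optimal control of Problem (M-LQ)$_\Theta$ for $(x,i)$* if $J_\Theta(x,i;\nu^*)=\inf_{\nu\in L^2_{\mathcal P}(\mathbb R^m)}J_\Theta(x,i;\nu)$. A pair $(\widehat\Theta,\widehat\nu)\in\mathcal H_\alpha\times L^2_{\mathcal P}(\mathbb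 R^m)$ is a *closed-loop optimal control of Problem (M-LQ)* if $J(x,i;\widehat\Theta(\alpha)X_{\widehat\Theta}(\cdot;x,i,\widehat\nu)+\widehat\nu)\le J(x,i;u)$ for all $(x,i)\in\mathbb R^n\times\mathcal S$ and all $u\in\mathcal U_{LQ}(x,i)$. **Proposition.** Assume $\mathcal H_\alpha\neq\emptyset$, and let $(\widehat\Theta,\widehat\nu)\in\mathcal H_\alpha\times L^2_{\mathcal P}(\mathbb R^m)$. Then $(\widehat\Theta,\widehat\nu)$ is a closed-loop optimal control of Problem (M-LQ) if and only if $\widehat\nu$ is an open-loop optimal control of Problem (M-LQ)$_{\widehat\Theta}$ for every initial value $(x,i)\in\mathbb R^n\times\mathcal S$. Moreover, for every $(x,i)$, $J_{\widehat\Theta}(x,i;\nu)=J(x,i;\widehat\Theta(\alpha)X_{\widehat\Theta}(\cdot;x,i,\nu)+\nu)$ for all $\nu\in L^2_{\mathcal P}(\mathbb R^m)$, and $$\mathcal U_{LQ}(x,i)=\big\{\widehat\Theta(\alpha)X_{\widehat\Theta}(\cdot;x,i,\nu)+\nu:\ \nu\in L^2_{\mathcal P}(\mathbb R^m)\big\}.$$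 -/

import Mathlib

open MeasureTheory ProbabilityTheory Filter Topology
open scoped NNReal ENNReal Matrix

namespace MarkovLQ

noncomputable section

/-- Lebesgue measure `dt` on the time axis `[0, ∞)`. -/
def timeMeasure : Measure ℝ≥0 := (volume : Measure ℝ).comap ((↑) : ℝ≥0 → ℝ)

/-! ### The Markov chain and its filtration -/

section Chain

variable {D : ℕ} {Ω : Type*} [mΩ : MeasurableSpace Ω]

/-- `G` is an irreducible generator on the finite state space `Fin D`: nonnegative off-diagonal
rates, zero row sums, and any state can be reached from any other through positive rates. -/
structure IsIrreducibleGenerator (G : Matrix (Fin D) (Fin D) ℝ) : Prop where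
  nonneg : ∀ i j, i ≠ j → 0 ≤ G i j
  diag : ∀ i, G i i = -∑ j ∈ Finset.univ.erase i, G i j
  irreducible : ∀ i j, Relation.ReflTransGen (fun k l => k ≠ l ∧ 0 < G k l) i j

/-- The σ-algebra generated by the `μ`-null sets. -/
abbrev nullSigma (μ : Measure Ω) : MeasurableSpace Ω :=
  MeasurableSpace.generateFrom {N | MeasurableSet N ∧ μ N = 0}

lemma nullSigma_le (μ : Measure Ω) : nullSigma μ ≤ mΩ :=
  MeasurableSpace.generateFrom_le fun _ hN => hN.1

/-- The natural filtration of `α`, augmented by all `μ`-null sets. -/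
def augFiltration (α : ℝ≥0 → Ω → Fin D) (hα : ∀ t, Measurable (α t)) (μ : Measure Ω) :
    Filtration ℝ≥0 mΩ :=
  Filtration.natural α (fun t => (hα t).stronglyMeasurable) ⊔
    Filtration.const ℝ≥0 (nullSigma μ) (nullSigma_le μ)

/-- Under `μ`, the process `α` is a continuous-time Markov chain with generator `G` and initial
state `i`, i.e. `μ(α_t = j | 𝓕_s) = (e^{(t-s)G})_{α_s, j}` for `s ≤ t`; its paths are right
continuous with left limits in the discrete space `Fin D`. -/
structure IsMarkovChainFrom (G : Matrix (Fin D) (Fin D) ℝ) (α : ℝ≥0 → Ω → Fin D)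
    (hα : ∀ t, Measurable (α t)) (μ : Measure Ω) (i : Fin D) : Prop where
  right_cont : ∀ ω t, ContinuousWithinAt (fun s => α s ω) (Set.Ici t) t
  left_lim : ∀ ω t, ∃ j, Tendsto (fun s => α s ω) (𝓝[<] t) (𝓝 j)
  init : ∀ᵐ ω ∂μ, α 0 ω = i
  markov : ∀ s t : ℝ≥0, s ≤ t → ∀ j : Fin D,
    μ[Set.indicator {ω | α t ω = j} (fun _ => (1 : ℝ)) | augFiltration α hα μ s] =ᵐ[μ]
      fun ω => NormedSpace.exp (((t : ℝ) - (s : ℝ)) • G) (α s ω) j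

end Chain

/-! ### Spaces of square-integrable processes

Processes are identified when they agree `dt ⊗ dμ`-almost everywhere; being progressively
measurable or predictable means having a version with this property. Square integrability does
not depend on the norm chosen on `Fin k → ℝ`. -/

section Processes

variable {Ω : Type*} [mΩ : MeasurableSpace Ω] {k : ℕ}

/-- `L²_𝔽(ℝᵏ)`: progressively measurable processes with `E ∫₀^∞ |φ(t)|² dt < ∞`. -/
def L2F (𝔽 : Filtration ℝ≥0 mΩ) (μ : Measure Ω) : Set (ℝ≥0 → Ω → Fin k → ℝ) :=
  {φ | MemLp (Function.uncurry φ) 2 (timeMeasure.prod μ) ∧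
    ∃ ψ, IsStronglyProgressive 𝔽 ψ ∧
      Function.uncurry φ =ᵐ[timeMeasure.prod μ] Function.uncurry ψ}

/-- `L²_𝒫(ℝᵏ)`: predictable processes with `E ∫₀^∞ |φ(t)|² dt < ∞`. -/
def L2P (𝔽 : Filtration ℝ≥0 mΩ) (μ : Measure Ω) : Set (ℝ≥0 → Ω → Fin k → ℝ) :=
  {φ | MemLp (Function.uncurry φ) 2 (timeMeasure.prod μ) ∧
    ∃ ψ, IsStronglyPredictable 𝔽 ψ ∧
      Function.uncurry φ =ᵐ[timeMeasure.prod μ] Function.uncurry ψ}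

end Processes

/-! ### The linear-quadratic problem -/

/-- Coefficients of the controlled state equation `Ẋ = A(α)X + B(α)u + b` and of the cost. -/
structure LQData (D n m : ℕ) (Ω : Type*) where
  A : Fin D → Matrix (Fin n) (Fin n) ℝ
  B : Fin D → Matrix (Fin n) (Fin m) ℝ
  Q : Fin D → Matrix (Fin n) (Fin n) ℝ
  S : Fin D → Matrix (Fin m) (Fin n) ℝ
  R : Fin D → Matrix (Fin m) (Fin m) ℝ
  b : ℝ≥0 → Ω → Fin n → ℝ
  q : ℝ≥0 → Ω → Fin n → ℝ
  ρ : ℝ≥0 → Ω → Fin m → ℝ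

namespace LQData

variable {D n m : ℕ} {Ω : Type*} [mΩ : MeasurableSpace Ω]

/-- Assumptions on the weights: `Q(i)` symmetric, `R(i) > 0`, `Q(i) - S(i)ᵀ R(i)⁻¹ S(i) ≥ 0`. -/
structure WeightsOK (L : LQData D n m Ω) : Prop where
  Q_symm : ∀ i, (L.Q i).IsSymm
  R_pos : ∀ i, (L.R i).PosDef
  schur : ∀ i, (L.Q i - (L.S i)ᵀ * (L.R i)⁻¹ * L.S i).PosSemidef

/-- The set of stabilizers: those `Θ` for which there are `P(i) > 0` with
`P(i)[A(i)+B(i)Θ(i)] + [A(i)+B(i)Θ(i)]ᵀP(i) + ∑ⱼ πᵢⱼ P(j) < 0` for every `i`. -/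
def stabilizers (L : LQData D n m Ω) (G : Matrix (Fin D) (Fin D) ℝ) :
    Set (Fin D → Matrix (Fin m) (Fin n) ℝ) :=
  {Θ | ∃ P : Fin D → Matrix (Fin n) (Fin n) ℝ, (∀ i, (P i).PosDef) ∧
    ∀ i, (-(P i * (L.A i + L.B i * Θ i) + (L.A i + L.B i * Θ i)ᵀ * P i
      + ∑ j, G i j • P j)).PosDef}

/-- `X` solves `Ẋ(t) = A(α_t)X(t) + B(α_t)u(t) + b(t)`, `X(0) = x`, in integrated form. -/
def IsState (L : LQData D n m Ω) (α : ℝ≥0 → Ω → Fin D) (𝔽 : Filtration ℝ≥0 mΩ) (μ : Measure Ω)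
    (x : Fin n → ℝ) (u : ℝ≥0 → Ω → Fin m → ℝ) (X : ℝ≥0 → Ω → Fin n → ℝ) : Prop :=
  IsStronglyProgressive 𝔽 X ∧
    ∀ᵐ ω ∂μ, Continuous (fun t => X t ω) ∧
      ∀ t, X t ω = x + ∫ s in Set.Iic t,
        (L.A (α s ω) *ᵥ X s ω + L.B (α s ω) *ᵥ u s ω + L.b s ω) ∂timeMeasure

/-- The state process `X(·; x, u)` (the solution is unique up to indistinguishability). -/
def state (L : LQData D n m Ω) (α : ℝ≥0 → Ω → Fin D) (𝔽 : Filtration ℝ≥0 mΩ) (μ : Measure Ω)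
    (x : Fin n → ℝ) (u : ℝ≥0 → Ω → Fin m → ℝ) : ℝ≥0 → Ω → Fin n → ℝ :=
  Classical.epsilon (L.IsState α 𝔽 μ x u)

/-- The cost functional `J(x; u)`, with expectation under `μ`. -/
def cost (L : LQData D n m Ω) (α : ℝ≥0 → Ω → Fin D) (𝔽 : Filtration ℝ≥0 mΩ) (μ : Measure Ω)
    (x : Fin n → ℝ) (u : ℝ≥0 → Ω → Fin m → ℝ) : ℝ :=
  ∫ ω, ∫ t,
    ((Matrix.fromBlocks (L.Q (α t ω)) (L.S (α t ω))ᵀ (L.S (α t ω)) (L.R (α t ω)) *ᵥ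
        Sum.elim (L.state α 𝔽 μ x u t ω) (u t ω)) ⬝ᵥ
        Sum.elim (L.state α 𝔽 μ x u t ω) (u t ω)
      + 2 * (Sum.elim (L.q t ω) (L.ρ t ω) ⬝ᵥ
        Sum.elim (L.state α 𝔽 μ x u t ω) (u t ω))) ∂timeMeasure ∂μ

/-- Admissible controls: `u ∈ L²_𝒫` whose state process lies in `L²_𝔽`. -/
def admissible (L : LQData D n m Ω) (α : ℝ≥0 → Ω → Fin D) (𝔽 : Filtration ℝ≥0 mΩ)
    (μ : Measure Ω) (x : Fin n → ℝ) : Set (ℝ≥0 → Ω → Fin m → ℝ) :=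
  {u | u ∈ L2P 𝔽 μ ∧ L.state α 𝔽 μ x u ∈ L2F 𝔽 μ}

/-- The coefficients `A_Θ, B, Q_Θ, S_Θ, R, b, q_Θ, ρ` of the problem transformed by `Θ`. -/
def transform (L : LQData D n m Ω) (α : ℝ≥0 → Ω → Fin D)
    (Θ : Fin D → Matrix (Fin m) (Fin n) ℝ) : LQData D n m Ω where
  A i := L.A i + L.B i * Θ i
  B := L.B
  Q i := L.Q i + (L.S i)ᵀ * Θ i + (Θ i)ᵀ * L.S i + (Θ i)ᵀ * L.R i * Θ i
  S i := L.S i + L.R i * Θ i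
  R := L.R
  b := L.b
  q t ω := L.q t ω + (Θ (α t ω))ᵀ *ᵥ L.ρ t ω
  ρ := L.ρ

/-- The outcome `Θ(α)X_Θ(·; x, ν) + ν` of the feedback pair `(Θ, ν)`. -/
def feedback (L : LQData D n m Ω) (α : ℝ≥0 → Ω → Fin D) (𝔽 : Filtration ℝ≥0 mΩ) (μ : Measure Ω)
    (Θ : Fin D → Matrix (Fin m) (Fin n) ℝ) (x : Fin n → ℝ) (ν : ℝ≥0 → Ω → Fin m → ℝ) :
    ℝ≥0 → Ω → Fin m → ℝ :=
  fun t ω => Θ (α t ω) *ᵥ (L.transform α Θ).state α 𝔽 μ x ν t ω + ν t ω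

/-- `(Θ, ν)` is a closed-loop optimal control: `Θ` is a stabilizer, `ν` is in `L²_𝒫` whatever the
initial regime, and `J(x,i; Θ(α)X_Θ + ν) ≤ J(x,i; u)` for all `(x,i)` and all admissible `u`.
Here `P i` is the law under which the chain starts at `i`. -/
def IsClosedLoopOptimal (L : LQData D n m Ω) (G : Matrix (Fin D) (Fin D) ℝ)
    (α : ℝ≥0 → Ω → Fin D) (hα : ∀ t, Measurable (α t)) (P : Fin D → Measure Ω)
    (Θ : Fin D → Matrix (Fin m) (Fin n) ℝ) (ν : ℝ≥0 → Ω → Fin m → ℝ) : Prop :=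
  Θ ∈ L.stabilizers G ∧ (∀ i, ν ∈ L2P (augFiltration α hα (P i)) (P i)) ∧
    ∀ (x : Fin n → ℝ) (i : Fin D),
      ∀ u ∈ L.admissible α (augFiltration α hα (P i)) (P i) x,
        L.cost α (augFiltration α hα (P i)) (P i) x
            (L.feedback α (augFiltration α hα (P i)) (P i) Θ x ν)
          ≤ L.cost α (augFiltration α hα (P i)) (P i) x u

/-- `ν` is an open-loop optimal control, for the initial value `(x, i)`, of the problem transformed
by `Θ`: it minimizes `J_Θ(x,i; ·)` over `L²_𝒫`. -/
def IsOpenLoopOptimalTransformed (L : LQData D n m Ω)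
    (α : ℝ≥0 → Ω → Fin D) (hα : ∀ t, Measurable (α t)) (P : Fin D → Measure Ω)
    (Θ : Fin D → Matrix (Fin m) (Fin n) ℝ) (x : Fin n → ℝ) (i : Fin D)
    (ν : ℝ≥0 → Ω → Fin m → ℝ) : Prop :=
  ν ∈ L2P (augFiltration α hα (P i)) (P i) ∧
    IsMinOn ((L.transform α Θ).cost α (augFiltration α hα (P i)) (P i) x)
      (L2P (augFiltration α hα (P i)) (P i)) ν

end LQData

end

end MarkovLQ

/-!
The gain `Θ` turns the state equation driven by `u = Θ(α) X + v` into the transformed equation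
driven by `v`, so for a stabilizer `Θ` the map `v ↦ Θ(α) X_Θ + v` carries `L²_𝒫` onto the
admissible controls, with inverse `u ↦ u - Θ(α) X`, and it carries `J_Θ` to `J` because `R` is
symmetric. Minimizing `J` over admissible controls is therefore the same as minimizing `J_Θ` over
`L²_𝒫`.

Two analytic facts make this correspondence land in the right spaces. If `Θ` is a stabilizer, then
`X_Θ` is square integrable: applying Dynkin's formula to `⟨P(α) X_Θ, X_Θ⟩`, where `P` is the family
from the Lyapunov inequality, bounds `E ∫₀ᵀ |X_Θ|²` uniformly in `T`. And `Θ(α) X` has a predictable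
version, since `α` differs from its left limit at only countably many times.
-/

namespace MarkovLQ

section TimeMeasure

variable {E : Type*} [NormedAddCommGroup E]

lemma measurableEmbedding_coe_nnreal : MeasurableEmbedding ((↑) : ℝ≥0 → ℝ) :=
  MeasurableEmbedding.subtype_coe measurableSet_Ici

lemma map_coe_timeMeasure : timeMeasure.map ((↑) : ℝ≥0 → ℝ) = volume.restrict (Set.Ici 0) := by
  rw [timeMeasure, measurableEmbedding_coe_nnreal.map_comap, NNReal.range_coe]

lemma map_coe_timeMeasure_restrict_Iic (t : ℝ≥0) :
    (timeMeasure.restrict (Set.Iic t)).map ((↑) : ℝ≥0 → ℝ) =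
      volume.restrict (Set.Icc 0 (t : ℝ)) := by
  have preimage_Iic : Set.Iic t = ((↑) : ℝ≥0 → ℝ) ⁻¹' Set.Iic (t : ℝ) := by ext; simp
  rw [preimage_Iic, ← measurableEmbedding_coe_nnreal.restrict_map, map_coe_timeMeasure,
    Measure.restrict_restrict measurableSet_Iic, Set.inter_comm, Set.Ici_inter_Iic]

lemma timeMeasure_Iic (t : ℝ≥0) : timeMeasure (Set.Iic t) = t := by
  have h := congrArg (fun μ : Measure ℝ => μ Set.univ) (map_coe_timeMeasure_restrict_Iic t)
  simpa [measurableEmbedding_coe_nnreal.map_apply] using h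

instance : IsLocallyFiniteMeasure timeMeasure :=
  ⟨fun t => ⟨Set.Iic (t + 1), Iic_mem_nhds (lt_add_one t), by simp [timeMeasure_Iic]⟩⟩

instance (t : ℝ≥0) : IsFiniteMeasure (timeMeasure.restrict (Set.Iic t)) :=
  ⟨by simp [timeMeasure_Iic]⟩

instance : NullSingletonClass timeMeasure :=
  ⟨fun t => by rw [timeMeasure, measurableEmbedding_coe_nnreal.comap_apply]; simp⟩

lemma setIntegral_Iic_eq_intervalIntegral [NormedSpace ℝ E] (f : ℝ≥0 → E) (t : ℝ≥0) :
    ∫ s in Set.Iic t, f s ∂timeMeasure = ∫ s in (0 : ℝ)..t, f s.toNNReal := by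
  rw [intervalIntegral.integral_of_le t.coe_nonneg, ← integral_Icc_eq_integral_Ioc,
    ← map_coe_timeMeasure_restrict_Iic, measurableEmbedding_coe_nnreal.integral_map]
  simp only [Real.toNNReal_coe]

lemma integrableOn_Iic_iff_intervalIntegrable (f : ℝ≥0 → E) (t : ℝ≥0) :
    IntegrableOn f (Set.Iic t) timeMeasure ↔
      IntervalIntegrable (fun s : ℝ => f s.toNNReal) volume 0 t := by
  rw [intervalIntegrable_iff_integrableOn_Icc_of_le t.coe_nonneg, IntegrableOn, IntegrableOn,
    ← map_coe_timeMeasure_restrict_Iic, measurableEmbedding_coe_nnreal.integrable_map_iff]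
  simp [Function.comp_def]

lemma isCompact_Iic {X : Type*} [PartialOrder X] [OrderBot X] [TopologicalSpace X]
    [CompactIccSpace X] (t : X) : IsCompact (Set.Iic t) := by
  rw [← Set.Icc_bot]
  exact isCompact_Icc

lemma locallyIntegrable_iff_integrableOn_Iic {f : ℝ≥0 → E} :
    LocallyIntegrable f timeMeasure ↔ ∀ t, IntegrableOn f (Set.Iic t) timeMeasure :=
  ⟨fun hf t => hf.integrableOn_isCompact (isCompact_Iic t),
    fun hf t => ⟨Set.Iic (t + 1), Iic_mem_nhds (lt_add_one t), hf (t + 1)⟩⟩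

lemma continuous_setIntegral_Iic [NormedSpace ℝ E] {f : ℝ≥0 → E}
    (hf : LocallyIntegrable f timeMeasure) :
    Continuous fun t => ∫ s in Set.Iic t, f s ∂timeMeasure := by
  simp_rw [setIntegral_Iic_eq_intervalIntegral]
  refine continuous_iff_continuousAt.2 fun t => ?_
  have primitive : ContinuousOn (fun r : ℝ => ∫ s in (0 : ℝ)..r, f s.toNNReal)
      (Set.uIcc 0 ((t + 1 : ℝ≥0) : ℝ)) :=
    intervalIntegral.continuousOn_primitive_interval ((intervalIntegrable_iff' (by simp)).1
      ((integrableOn_Iic_iff_intervalIntegrable f (t + 1)).1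
        (hf.integrableOn_isCompact (isCompact_Iic _))))
  have maps : Set.MapsTo ((↑) : ℝ≥0 → ℝ) (Set.Iic (t + 1))
      (Set.uIcc 0 ((t + 1 : ℝ≥0) : ℝ)) := fun r hr => by
    rw [Set.uIcc_of_le (NNReal.coe_nonneg _)]
    exact ⟨r.2, by exact_mod_cast hr⟩
  exact (primitive.comp NNReal.continuous_coe.continuousOn maps).continuousAt
    (Iic_mem_nhds (lt_add_one t))

lemma setIntegral_norm_Iic_mono {f : ℝ≥0 → E} (hf : LocallyIntegrable f timeMeasure) :
    Monotone fun t => ∫ s in Set.Iic t, ‖f s‖ ∂timeMeasure := fun _ t hst =>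
  setIntegral_mono_set (hf.integrableOn_isCompact (isCompact_Iic t)).norm
    (ae_of_all _ fun _ => norm_nonneg _) (Set.Iic_subset_Iic.2 hst).eventuallyLE

lemma norm_setIntegral_Iic_le [NormedSpace ℝ E] {f : ℝ≥0 → E} {M : ℝ} {t : ℝ≥0}
    (hf : ∀ s ≤ t, ‖f s‖ ≤ M) : ‖∫ s in Set.Iic t, f s ∂timeMeasure‖ ≤ M * t := by
  have volume_lt_top : timeMeasure (Set.Iic t) < ∞ := by simp [timeMeasure_Iic]
  refine (norm_setIntegral_le_of_norm_le_const volume_lt_top hf).trans_eq ?_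
  simp [Measure.real, timeMeasure_Iic]

end TimeMeasure

section Primitives

lemma le_mul_exp_of_le_add_mul_setIntegral {y : ℝ≥0 → ℝ} (hy : Continuous y) {K C : ℝ}
    (hC : 0 ≤ C) {T : ℝ≥0} (h : ∀ t ≤ T, y t ≤ K + C * ∫ s in Set.Iic t, y s ∂timeMeasure) :
    y T ≤ K * Real.exp (C * T) := by
  simp_rw [setIntegral_Iic_eq_intervalIntegral] at h
  have hy' : Continuous fun s : ℝ => y s.toNNReal := hy.comp continuous_real_toNNReal
  have deriv_rhs : ∀ r : ℝ, HasDerivAt (fun r => K + C * ∫ s in (0 : ℝ)..r, y s.toNNReal)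
      (C * y r.toNNReal) r := fun r =>
    ((hy'.integral_hasStrictDerivAt 0 r).hasDerivAt.const_mul C).const_add K
  have rhs_le := le_gronwallBound_of_liminf_deriv_right_le (δ := K) (K := C) (ε := 0)
    (fun r _ => (deriv_rhs r).continuousAt.continuousWithinAt)
    (fun r _ s hs => (deriv_rhs r).hasDerivWithinAt.liminf_right_slope_le hs) (by simp)
    (fun r hr => by
      have hr' := h r.toNNReal (Real.toNNReal_le_iff_le_coe.2 hr.2.le)
      rw [Real.coe_toNNReal _ hr.1] at hr'
      simpa using mul_le_mul_of_nonneg_left hr' hC) T ⟨T.2, le_rfl⟩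
  rw [gronwallBound_ε0, sub_zero] at rhs_le
  exact (h T le_rfl).trans rhs_le

lemma intervalIntegral_primitive_mul_primitive {f g : ℝ → ℝ} {a b : ℝ}
    (hf : IntervalIntegrable f volume a b) (hg : IntervalIntegrable g volume a b) (x y : ℝ) :
    (x + ∫ s in a..b, f s) * (y + ∫ s in a..b, g s) = x * y +
      ∫ t in a..b, (f t * (y + ∫ s in a..t, g s) + (x + ∫ s in a..t, f s) * g t) := by
  have const_ac : ∀ c : ℝ, AbsolutelyContinuousOnInterval (fun _ => c) a b := fun c =>
    (LipschitzWith.const c).lipschitzOnWith.absolutelyContinuousOnInterval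
  have parts := AbsolutelyContinuousOnInterval.integral_deriv_mul_eq_sub
    ((const_ac x).add (hf.absolutelyContinuousOnInterval_intervalIntegral Set.left_mem_uIcc))
    ((const_ac y).add (hg.absolutelyContinuousOnInterval_intervalIntegral Set.left_mem_uIcc))
  simp only [Pi.add_apply, intervalIntegral.integral_same, add_zero] at parts
  rw [← sub_eq_iff_eq_add', ← parts]
  refine intervalIntegral.integral_congr_ae ?_
  filter_upwards [hf.ae_hasDerivAt_integral, hg.ae_hasDerivAt_integral] with t hft hgt ht
  have ht' : t ∈ Set.uIcc a b := Set.uIoc_subset_uIcc ht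
  have deriv_f := ((hft ht' a Set.left_mem_uIcc).const_add x).deriv
  have deriv_g := ((hgt ht' a Set.left_mem_uIcc).const_add y).deriv
  exact congrArg₂ (· + ·) (congrArg (· * _) deriv_f) (congrArg (_ * ·) deriv_g)

lemma setIntegral_Iic_primitive_mul_primitive {f g : ℝ≥0 → ℝ}
    (hf : LocallyIntegrable f timeMeasure) (hg : LocallyIntegrable g timeMeasure) (x y : ℝ)
    (t : ℝ≥0) :
    (x + ∫ s in Set.Iic t, f s ∂timeMeasure) * (y + ∫ s in Set.Iic t, g s ∂timeMeasure) =
      x * y + ∫ s in Set.Iic t, (f s * (y + ∫ r in Set.Iic s, g r ∂timeMeasure) +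
        (x + ∫ r in Set.Iic s, f r ∂timeMeasure) * g s) ∂timeMeasure := by
  have interval : ∀ {h : ℝ≥0 → ℝ}, LocallyIntegrable h timeMeasure →
      IntervalIntegrable (fun s : ℝ => h s.toNNReal) volume 0 t := fun hh =>
    (integrableOn_Iic_iff_intervalIntegrable _ t).1
      (hh.integrableOn_isCompact (isCompact_Iic t))
  simp_rw [setIntegral_Iic_eq_intervalIntegral]
  rw [intervalIntegral_primitive_mul_primitive (interval hf) (interval hg)]
  congr 1
  refine intervalIntegral.integral_congr fun s hs => ?_
  rw [Set.uIcc_of_le t.coe_nonneg] at hs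
  simp only [Real.coe_toNNReal s hs.1]

end Primitives

noncomputable section LinearODE

variable {E : Type*} [NormedAddCommGroup E] [NormedSpace ℝ E]

/-- `Y` is a continuous solution, in integrated form, of the linear equation
`Ẏ(t) = A(t) Y(t) + f(t)`, `Y(0) = x`. -/
structure IsLinearODESolution (A : ℝ≥0 → E →L[ℝ] E) (f : ℝ≥0 → E) (x : E) (Y : ℝ≥0 → E) :
    Prop where
  continuous : Continuous Y
  eq_add_integral : ∀ t, Y t = x + ∫ s in Set.Iic t, (A s (Y s) + f s) ∂timeMeasure

/-- The Picard iterates of the linear equation `Ẏ(t) = A(t) Y(t) + f(t)`, `Y(0) = x`. -/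
def picard (A : ℝ≥0 → E →L[ℝ] E) (f : ℝ≥0 → E) (x : E) : ℕ → ℝ≥0 → E
  | 0 => fun _ => x
  | k + 1 => fun t => x + ∫ s in Set.Iic t, (A s (picard A f x k s) + f s) ∂timeMeasure

lemma stronglyMeasurable_clm_apply {Ω F : Type*} {_ : MeasurableSpace Ω}
    [NormedAddCommGroup F] [NormedSpace ℝ F] {A : Ω → E →L[ℝ] F} {Y : Ω → E}
    (hA : StronglyMeasurable A) (hY : StronglyMeasurable Y) :
    StronglyMeasurable fun ω => A ω (Y ω) :=
  isBoundedBilinearMap_apply.continuous.comp_stronglyMeasurable (hA.prodMk hY)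

variable {A : ℝ≥0 → E →L[ℝ] E} {f : ℝ≥0 → E} {x : E} {C : ℝ}

lemma locallyIntegrable_clm_apply {Y : ℝ≥0 → E} (hA : StronglyMeasurable A)
    (hAC : ∀ s, ‖A s‖ ≤ C) (hY : Continuous Y) :
    LocallyIntegrable (fun s => A s (Y s)) timeMeasure := by
  refine (continuous_const.mul hY.norm).locallyIntegrable.mono (f := fun s => C * ‖Y s‖)
    (stronglyMeasurable_clm_apply hA hY.stronglyMeasurable).aestronglyMeasurable
    (ae_of_all _ fun s => ?_)
  exact ((A s).le_of_opNorm_le (hAC s) _).trans (le_abs_self _)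

lemma continuous_picard (hA : StronglyMeasurable A) (hAC : ∀ s, ‖A s‖ ≤ C)
    (hf : LocallyIntegrable f timeMeasure) (k : ℕ) : Continuous (picard A f x k) := by
  induction k with
  | zero => exact continuous_const
  | succ k ih =>
    exact continuous_const.add
      (continuous_setIntegral_Iic ((locallyIntegrable_clm_apply hA hAC ih).add hf))

lemma setIntegral_affine_sub_affine {Y Z : ℝ≥0 → E} (hA : StronglyMeasurable A)
    (hAC : ∀ s, ‖A s‖ ≤ C) (hf : LocallyIntegrable f timeMeasure) (hY : Continuous Y)
    (hZ : Continuous Z) (t : ℝ≥0) :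
    ∫ s in Set.Iic t, (A s (Y s) + f s) ∂timeMeasure -
        ∫ s in Set.Iic t, (A s (Z s) + f s) ∂timeMeasure =
      ∫ s in Set.Iic t, A s (Y s - Z s) ∂timeMeasure := by
  have integrable : ∀ {W : ℝ≥0 → E}, Continuous W →
      IntegrableOn (fun s => A s (W s) + f s) (Set.Iic t) timeMeasure := fun hW =>
    ((locallyIntegrable_clm_apply hA hAC hW).add hf).integrableOn_isCompact (isCompact_Iic t)
  rw [← integral_sub (integrable hY) (integrable hZ)]
  simp only [add_sub_add_right_eq_sub, map_sub]

lemma setIntegral_Iic_mul_exp_le (C : ℝ) (t : ℝ≥0) :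
    ∫ s in Set.Iic t, C * Real.exp (2 * C * s) ∂timeMeasure ≤ Real.exp (2 * C * t) / 2 := by
  have primitive : ∀ s : ℝ, HasDerivAt (fun s => Real.exp (2 * C * s) / 2)
      (C * Real.exp (2 * C * s)) s := fun s =>
    ((((hasDerivAt_id s).const_mul (2 * C)).exp).div_const 2).congr_deriv (by
      simp only [id, mul_one]; ring)
  have integral_eq := intervalIntegral.integral_eq_sub_of_hasDerivAt (a := 0) (b := (t : ℝ))
    (fun s _ => primitive s) (Continuous.intervalIntegrable (by fun_prop) _ _)
  have coe_toNNReal : Set.EqOn (fun s : ℝ => C * Real.exp (2 * C * (s.toNNReal : ℝ)))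
      (fun s => C * Real.exp (2 * C * s)) (Set.uIcc 0 (t : ℝ)) := fun s hs => by
    rw [Set.uIcc_of_le t.coe_nonneg] at hs
    simp only [Real.coe_toNNReal _ hs.1]
  rw [setIntegral_Iic_eq_intervalIntegral (fun s : ℝ≥0 => C * Real.exp (2 * C * s)),
    intervalIntegral.integral_congr coe_toNNReal, integral_eq]
  linarith [Real.exp_pos (2 * C * 0)]

/-- Measured with the weight `exp (-2 C t)`, the Picard map is a contraction of ratio `1 / 2`. -/
lemma norm_picard_succ_sub_le (hA : StronglyMeasurable A) (hAC : ∀ s, ‖A s‖ ≤ C)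
    (hf : LocallyIntegrable f timeMeasure) {T : ℝ≥0} (k : ℕ) {t : ℝ≥0} (htT : t ≤ T) :
    ‖picard A f x (k + 1) t - picard A f x k t‖ ≤
      (∫ s in Set.Iic T, ‖A s x + f s‖ ∂timeMeasure) * (1 / 2) ^ k * Real.exp (2 * C * t) := by
  have hC : 0 ≤ C := (norm_nonneg _).trans (hAC 0)
  have first_step := (locallyIntegrable_clm_apply hA hAC continuous_const (Y := fun _ => x)).add hf
  set M := ∫ s in Set.Iic T, ‖A s x + f s‖ ∂timeMeasure
  have hM : 0 ≤ M := integral_nonneg fun _ => norm_nonneg _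
  induction k generalizing t with
  | zero =>
    simp only [picard, add_sub_cancel_left, pow_zero, mul_one]
    refine (norm_integral_le_integral_norm _).trans
      ((setIntegral_norm_Iic_mono first_step htT).trans ?_)
    exact le_mul_of_one_le_right hM (Real.one_le_exp (by positivity))
  | succ k ih =>
    have hp := continuous_picard (x := x) hA hAC hf
    calc ‖picard A f x (k + 1 + 1) t - picard A f x (k + 1) t‖
        = ‖∫ s in Set.Iic t, A s (picard A f x (k + 1) s - picard A f x k s) ∂timeMeasure‖ := by
          rw [← setIntegral_affine_sub_affine hA hAC hf (hp _) (hp _), picard, picard,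
            add_sub_add_left_eq_sub, ← picard]
      _ ≤ ∫ s in Set.Iic t, M * (1 / 2) ^ k * (C * Real.exp (2 * C * s)) ∂timeMeasure := by
          refine norm_integral_le_of_norm_le ((Continuous.locallyIntegrable
            (by fun_prop)).integrableOn_isCompact (isCompact_Iic t)) ?_
          refine (ae_restrict_iff' measurableSet_Iic).2 (ae_of_all _ fun s hs => ?_)
          refine ((A s).le_of_opNorm_le_of_le (hAC s) (ih (hs.trans htT))).trans_eq ?_
          ring
      _ ≤ M * (1 / 2) ^ k * (Real.exp (2 * C * t) / 2) := by
          rw [integral_const_mul]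
          exact mul_le_mul_of_nonneg_left (setIntegral_Iic_mul_exp_le C t) (by positivity)
      _ = M * (1 / 2) ^ (k + 1) * Real.exp (2 * C * t) := by ring

lemma exists_tendsto_picard [CompleteSpace E] (hA : StronglyMeasurable A) (hAC : ∀ s, ‖A s‖ ≤ C)
    (hf : LocallyIntegrable f timeMeasure) (x : E) : ∃ Y : ℝ≥0 → E, ∀ T, ∃ M,
      ∀ t ≤ T, ∀ k, ‖picard A f x k t - Y t‖ ≤ M * (1 / 2) ^ k := by
  have hC : 0 ≤ C := (norm_nonneg _).trans (hAC 0)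
  set M : ℝ≥0 → ℝ := fun T =>
    (∫ s in Set.Iic T, ‖A s x + f s‖ ∂timeMeasure) * Real.exp (2 * C * T)
  have dist_le : ∀ T, ∀ t ≤ T, ∀ k,
      dist (picard A f x k t) (picard A f x (k + 1) t) ≤ M T * (1 / 2) ^ k := fun T t ht k => by
    rw [dist_comm, dist_eq_norm]
    refine (norm_picard_succ_sub_le hA hAC hf k ht).trans ?_
    rw [mul_right_comm]
    simp only [M]
    gcongr
  choose Y hY using fun t => cauchySeq_tendsto_of_complete
    (cauchySeq_of_le_geometric (1 / 2) (M t) (by norm_num) (dist_le t t le_rfl))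
  refine ⟨Y, fun T => ⟨2 * M T, fun t ht k => ?_⟩⟩
  rw [← dist_eq_norm]
  refine (dist_le_of_le_geometric_of_tendsto (1 / 2) (M T) (by norm_num) (dist_le T t ht)
    (hY t) k).trans_eq ?_
  ring

lemma tendsto_mul_one_half_pow (M : ℝ) : Tendsto (fun k : ℕ => M * (1 / 2) ^ k) atTop (𝓝 0) := by
  simpa using
    (tendsto_pow_atTop_nhds_zero_of_lt_one one_half_pos.le one_half_lt_one).const_mul M

section PicardLimit

variable {Y : ℝ≥0 → E}

lemma tendsto_picard (hY : ∀ T, ∃ M, ∀ t ≤ T, ∀ k, ‖picard A f x k t - Y t‖ ≤ M * (1 / 2) ^ k)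
    (t : ℝ≥0) : Tendsto (fun k => picard A f x k t) atTop (𝓝 (Y t)) :=
  let ⟨M, hM⟩ := hY t
  tendsto_iff_norm_sub_tendsto_zero.2
    (squeeze_zero (fun _ => norm_nonneg _) (hM t le_rfl) (tendsto_mul_one_half_pow M))

lemma continuous_of_picard (hA : StronglyMeasurable A) (hAC : ∀ s, ‖A s‖ ≤ C)
    (hf : LocallyIntegrable f timeMeasure)
    (hY : ∀ T, ∃ M, ∀ t ≤ T, ∀ k, ‖picard A f x k t - Y t‖ ≤ M * (1 / 2) ^ k) :
    Continuous Y := by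
  refine TendstoLocallyUniformly.continuous (F := picard A f x) (p := atTop)
    (tendstoLocallyUniformly_iff_forall_isCompact.2 fun K hK => ?_)
    (Frequently.of_forall (continuous_picard hA hAC hf))
  obtain ⟨T, hT⟩ := hK.bddAbove
  obtain ⟨M, hM⟩ := hY T
  refine Metric.tendstoUniformlyOn_iff.2 fun ε hε => ?_
  filter_upwards [(tendsto_mul_one_half_pow M).eventually_lt_const hε] with k hk t ht
  rw [dist_comm, dist_eq_norm]
  exact (hM t (hT ht) k).trans_lt hk

lemma isLinearODESolution_of_picard (hA : StronglyMeasurable A) (hAC : ∀ s, ‖A s‖ ≤ C)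
    (hf : LocallyIntegrable f timeMeasure)
    (hY : ∀ T, ∃ M, ∀ t ≤ T, ∀ k, ‖picard A f x k t - Y t‖ ≤ M * (1 / 2) ^ k) :
    IsLinearODESolution A f x Y := by
  have hYc := continuous_of_picard hA hAC hf hY
  refine ⟨hYc, fun t => ?_⟩
  obtain ⟨M, hM⟩ := hY t
  refine tendsto_nhds_unique ((tendsto_add_atTop_iff_nat 1).2 (tendsto_picard hY t))
    (tendsto_const_nhds.add (tendsto_iff_norm_sub_tendsto_zero.2 ?_))
  refine squeeze_zero (fun _ => norm_nonneg _) (fun k => ?_)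
    (tendsto_mul_one_half_pow (C * M * t))
  rw [setIntegral_affine_sub_affine hA hAC hf (continuous_picard hA hAC hf k) hYc]
  refine (norm_setIntegral_Iic_le fun s hs =>
    (A s).le_of_opNorm_le_of_le (hAC s) (hM s hs k)).trans_eq ?_
  ring

end PicardLimit

lemma IsLinearODESolution.norm_le {Y : ℝ≥0 → E} (hY : IsLinearODESolution A f x Y)
    (hA : StronglyMeasurable A) (hAC : ∀ s, ‖A s‖ ≤ C) (hf : LocallyIntegrable f timeMeasure)
    (t : ℝ≥0) :
    ‖Y t‖ ≤ (‖x‖ + ∫ s in Set.Iic t, ‖f s‖ ∂timeMeasure) * Real.exp (C * t) := by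
  have hC : 0 ≤ C := (norm_nonneg _).trans (hAC 0)
  refine le_mul_exp_of_le_add_mul_setIntegral hY.continuous.norm hC fun r hr => ?_
  have hAY := (locallyIntegrable_clm_apply hA hAC hY.continuous).integrableOn_isCompact
    (isCompact_Iic r)
  have linear_part : ‖∫ s in Set.Iic r, A s (Y s) ∂timeMeasure‖ ≤
      C * ∫ s in Set.Iic r, ‖Y s‖ ∂timeMeasure := by
    rw [← integral_const_mul]
    exact norm_integral_le_of_norm_le ((hY.continuous.norm.locallyIntegrable.integrableOn_isCompact
      (isCompact_Iic r)).const_mul C) (ae_of_all _ fun s => (A s).le_of_opNorm_le (hAC s) _)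
  have forcing : ‖∫ s in Set.Iic r, f s ∂timeMeasure‖ ≤ ∫ s in Set.Iic t, ‖f s‖ ∂timeMeasure :=
    (norm_integral_le_integral_norm _).trans (setIntegral_norm_Iic_mono hf hr)
  rw [hY.eq_add_integral r, integral_add hAY (hf.integrableOn_isCompact (isCompact_Iic r))]
  linarith [norm_add_le x (∫ s in Set.Iic r, A s (Y s) ∂timeMeasure +
    ∫ s in Set.Iic r, f s ∂timeMeasure), norm_add_le (∫ s in Set.Iic r, A s (Y s) ∂timeMeasure)
    (∫ s in Set.Iic r, f s ∂timeMeasure)]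

lemma IsLinearODESolution.unique {Y Z : ℝ≥0 → E} (hY : IsLinearODESolution A f x Y)
    (hZ : IsLinearODESolution A f x Z) (hA : StronglyMeasurable A) (hAC : ∀ s, ‖A s‖ ≤ C)
    (hf : LocallyIntegrable f timeMeasure) : Y = Z := by
  have difference : IsLinearODESolution A 0 0 (Y - Z) :=
    ⟨hY.continuous.sub hZ.continuous, fun t => by
      rw [Pi.sub_apply, hY.eq_add_integral t, hZ.eq_add_integral t, add_sub_add_left_eq_sub,
        setIntegral_affine_sub_affine hA hAC hf hY.continuous hZ.continuous]
      simp only [Pi.sub_apply, Pi.zero_apply, add_zero, zero_add]⟩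
  funext t
  simpa [sub_eq_zero] using difference.norm_le hA hAC locallyIntegrable_zero t

end LinearODE

noncomputable section Measurability

lemma measurable_uncurry_comp_of_countable_range {S T Ω β : Type*} [MeasurableSpace S]
    [MeasurableSpace T] [MeasurableSingletonClass T] {mΩ : MeasurableSpace Ω} [MeasurableSpace β]
    {X : T → Ω → β} {τ : S → T} (hτ : Measurable τ) (hτc : (Set.range τ).Countable)
    (hX : ∀ s, Measurable (X (τ s))) : Measurable fun p : S × Ω => X (τ p.1) p.2 := by
  intro V hV
  have hpre : (fun p : S × Ω => X (τ p.1) p.2) ⁻¹' V =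
      ⋃ r ∈ Set.range τ, (τ ⁻¹' {r}) ×ˢ (X r ⁻¹' V) := by
    ext p
    refine ⟨fun h => Set.mem_biUnion ⟨p.1, rfl⟩ ⟨rfl, h⟩, fun h => ?_⟩
    obtain ⟨_, -, rfl, h⟩ := Set.mem_iUnion₂.1 h
    exact h
  rw [hpre]
  refine .biUnion hτc ?_
  rintro _ ⟨s, rfl⟩
  exact (hτ (measurableSet_singleton _)).prod (hX s hV)

/-- The grid point of mesh `1 / (k + 1)` lying just to the right of `t`. -/
def gridRight (k : ℕ) (t : ℝ≥0) : ℝ≥0 := (⌊(k + 1) * t⌋₊ + 1) / (k + 1)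

lemma lt_gridRight (k : ℕ) (t : ℝ≥0) : t < gridRight k t := by
  rw [gridRight, lt_div_iff₀ (by positivity), mul_comm]
  exact Nat.lt_floor_add_one _

lemma gridRight_le (k : ℕ) (t : ℝ≥0) : gridRight k t ≤ t + 1 / (k + 1) := by
  rw [gridRight, div_le_iff₀ (by positivity), add_mul t, one_div_mul_cancel (by positivity)]
  gcongr
  rw [mul_comm t]
  exact Nat.floor_le (by positivity)

lemma measurable_gridRight (k : ℕ) : Measurable (gridRight k) := by
  unfold gridRight
  fun_prop

lemma countable_range_gridRight (k : ℕ) : (Set.range (gridRight k)).Countable :=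
  (Set.countable_range fun m : ℕ => ((m : ℝ≥0) + 1) / (k + 1)).mono <| by
    rintro _ ⟨t, rfl⟩
    exact ⟨⌊(k + 1) * t⌋₊, rfl⟩

lemma tendsto_gridRight (t : ℝ≥0) : Tendsto (fun k => gridRight k t) atTop (𝓝 t) := by
  refine tendsto_of_tendsto_of_tendsto_of_le_of_le tendsto_const_nhds ?_
    (fun k => (lt_gridRight k t).le) (fun k => gridRight_le k t)
  simpa using tendsto_one_div_add_atTop_nhds_zero_nat.const_add t

/-- The grid point of mesh `1 / (k + 1)` lying just to the left of `t`, and `0` if `t = 0`. -/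
def gridLeft (k : ℕ) (t : ℝ≥0) : ℝ≥0 := ((⌈(k + 1) * t⌉₊ - 1 : ℕ) : ℝ≥0) / (k + 1)

lemma ceil_sub_one_eq_iff_mem_Ioc {k m : ℕ} {t : ℝ≥0} (ht : 0 < t) :
    ⌈(k + 1) * t⌉₊ - 1 = m ↔ t ∈ Set.Ioc ((m : ℝ≥0) / (k + 1)) ((m + 1 : ℝ≥0) / (k + 1)) := by
  have hceil : 0 < ⌈(k + 1) * t⌉₊ := Nat.ceil_pos.2 (by positivity)
  have hsucc : ⌈(k + 1) * t⌉₊ - 1 = m ↔ ⌈(k + 1) * t⌉₊ = m + 1 := by lia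
  rw [hsucc, Nat.ceil_eq_iff (Nat.succ_ne_zero _), Set.mem_Ioc, div_lt_iff₀ (by positivity),
    le_div_iff₀ (by positivity), mul_comm t]
  simp

lemma gridLeft_lt (k : ℕ) {t : ℝ≥0} (ht : 0 < t) : gridLeft k t < t :=
  ((ceil_sub_one_eq_iff_mem_Ioc ht).1 rfl).1

lemma le_gridLeft_add (k : ℕ) {t : ℝ≥0} (ht : 0 < t) : t ≤ gridLeft k t + 1 / (k + 1) := by
  have hle := ((ceil_sub_one_eq_iff_mem_Ioc (k := k) ht).1 rfl).2
  rwa [add_div] at hle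

lemma tendsto_gridLeft {t : ℝ≥0} (ht : 0 < t) :
    Tendsto (fun k => gridLeft k t) atTop (𝓝[<] t) := by
  refine tendsto_nhdsWithin_iff.2 ⟨?_, .of_forall fun k => gridLeft_lt k ht⟩
  refine tendsto_of_tendsto_of_tendsto_of_le_of_le (g := fun k : ℕ => t - 1 / (k + 1)) ?_
    tendsto_const_nhds (fun k => tsub_le_iff_right.2 (le_gridLeft_add k ht))
    (fun k => (gridLeft_lt k ht).le)
  simpa using (tendsto_const_nhds (x := t)).sub tendsto_one_div_add_atTop_nhds_zero_nat

variable {Ω : Type*} {mΩ : MeasurableSpace Ω} {𝔽 : Filtration ℝ≥0 mΩ}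

section MetrizableValued

variable {β : Type*} [TopologicalSpace β] [TopologicalSpace.PseudoMetrizableSpace β]
  {X Y : ℝ≥0 → Ω → β}

lemma stronglyMeasurable_uncurry_of_isStronglyProgressive (hX : IsStronglyProgressive 𝔽 X) :
    StronglyMeasurable (Function.uncurry X) := by
  refine stronglyMeasurable_of_tendsto (atTop : Filter ℕ)
    (f := fun k p => X (min p.1 k) p.2) (fun k => ?_) ?_
  · have hmin : Measurable fun p : ℝ≥0 × Ω =>
        (⟨min p.1 k, Set.mem_Iic.2 (min_le_right _ _)⟩ : Set.Iic (k : ℝ≥0)) :=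
      (measurable_fst.min measurable_const).subtype_mk
    exact (hX k).comp_measurable
      (@Measurable.prodMk _ _ _ _ _ (𝔽 k) _ _ hmin (measurable_snd.mono le_rfl (𝔽.le _)))
  · refine tendsto_pi_nhds.2 fun p => tendsto_const_nhds.congr' ?_
    filter_upwards [tendsto_natCast_atTop_atTop.eventually_ge_atTop p.1] with k hk
    rw [min_eq_left hk, Function.uncurry]

variable [SecondCountableTopology β]

lemma isStronglyProgressive_of_rightContinuous (hX : StronglyAdapted 𝔽 X)
    (hc : ∀ ω t, ContinuousWithinAt (fun s => X s ω) (Set.Ici t) t) :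
    IsStronglyProgressive 𝔽 X := by
  borelize β
  intro t
  refine @stronglyMeasurable_of_tendsto (Set.Iic t × Ω) β ℕ (MeasurableSpace.prod _ (𝔽 t)) _ _
    atTop _ _ (fun k p => X (min (gridRight k p.1) t) p.2) _ (fun k => ?_) ?_
  · refine Measurable.stronglyMeasurable ?_
    refine measurable_uncurry_comp_of_countable_range (mΩ := 𝔽 t)
      (τ := fun s : Set.Iic t => min (gridRight k s) t)
      (((measurable_gridRight k).comp measurable_subtype_coe).min measurable_const) ?_
      fun s => ((hX _).mono (𝔽.mono (min_le_right _ _))).measurable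
    refine ((countable_range_gridRight k).image (min · t)).mono ?_
    rintro _ ⟨s, rfl⟩
    exact ⟨_, ⟨s, rfl⟩, rfl⟩
  · refine tendsto_pi_nhds.2 fun p => ?_
    have hgrid : Tendsto (fun k => min (gridRight k p.1) t) atTop (𝓝[≥] (p.1 : ℝ≥0)) := by
      refine tendsto_nhdsWithin_iff.2
        ⟨?_, .of_forall fun k => le_min (lt_gridRight k p.1).le p.1.2⟩
      simpa [min_eq_left p.1.2.out] using
        (tendsto_gridRight (p.1 : ℝ≥0)).min (tendsto_const_nhds (x := t))
    exact (hc p.2 p.1).tendsto.comp hgrid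

lemma isStronglyPredictable_gridLeft (hX : StronglyAdapted 𝔽 X) (k : ℕ) :
    IsStronglyPredictable 𝔽 fun t => X (gridLeft k t) := by
  borelize β
  refine Measurable.stronglyMeasurable fun V hV => ?_
  have hpre : (fun p : ℝ≥0 × Ω => X (gridLeft k p.1) p.2) ⁻¹' V =
      ({⊥} ×ˢ (X ⊥ ⁻¹' V)) ∪ ⋃ m : ℕ, Set.Ioc ((m : ℝ≥0) / (k + 1)) ((m + 1 : ℝ≥0) / (k + 1)) ×ˢ
        (X ((m : ℝ≥0) / (k + 1)) ⁻¹' V) := by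
    ext ⟨t, ω⟩
    rcases eq_zero_or_pos t with rfl | ht
    · simp [gridLeft]
    · simp [ht.ne', ← ceil_sub_one_eq_iff_mem_Ioc ht, gridLeft]
  exact hpre ▸ (measurableSet_predictable_singleton_bot_prod ((hX _).measurable hV)).union
    (.iUnion fun m => measurableSet_predictable_Ioc_prod _ _ ((hX _).measurable hV))

lemma isStronglyPredictable_of_tendsto_nhdsLT (hX : StronglyAdapted 𝔽 X) (h0 : Y 0 = X 0)
    (hl : ∀ ω t, 0 < t → Tendsto (fun s => X s ω) (𝓝[<] t) (𝓝 (Y t ω))) :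
    IsStronglyPredictable 𝔽 Y := by
  refine @stronglyMeasurable_of_tendsto (ℝ≥0 × Ω) β ℕ 𝔽.predictable _ _ atTop _ _
    (fun k p => X (gridLeft k p.1) p.2) _ (isStronglyPredictable_gridLeft hX)
    (tendsto_pi_nhds.2 fun ⟨t, ω⟩ => ?_)
  rcases eq_zero_or_pos t with rfl | ht
  · simpa [Function.uncurry, gridLeft, h0] using tendsto_const_nhds
  · exact (hl ω t ht).comp (tendsto_gridLeft ht)

end MetrizableValued

section NullSets

variable {β : Type*} [TopologicalSpace β] [Zero β] {f : ℝ≥0 → Ω → β}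

lemma isStronglyProgressive_indicator (hf : IsStronglyProgressive 𝔽 f) {N : Set Ω}
    (hN : MeasurableSet[𝔽 0] N) : IsStronglyProgressive 𝔽 fun t => N.indicator (f t) := fun t =>
  (hf t).indicator (s := Prod.snd ⁻¹' N)
    ((@measurable_snd _ _ _ (𝔽 t)) (𝔽.mono (zero_le (a := t)) _ hN))

lemma exists_isStronglyProgressive_forall_of_ae {μ : Measure Ω}
    (hnull : ∀ N, MeasurableSet N → μ N = 0 → MeasurableSet[𝔽 0] N)
    (hf : IsStronglyProgressive 𝔽 f) {p : (ℝ≥0 → β) → Prop} (hp0 : p 0)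
    (hp : ∀ᵐ ω ∂μ, p fun t => f t ω) :
    ∃ g, IsStronglyProgressive 𝔽 g ∧ (∀ ω, p fun t => g t ω) ∧
      ∀ᵐ ω ∂μ, ∀ t, g t ω = f t ω := by
  obtain ⟨N, hpN, hNm, hN0⟩ := exists_measurable_superset_of_null hp
  refine ⟨fun t => Nᶜ.indicator (f t), isStronglyProgressive_indicator hf (hnull N hNm hN0).compl,
    fun ω => ?_, ?_⟩
  · by_cases hω : ω ∈ N
    · rwa [show (fun t => Nᶜ.indicator (f t) ω) = 0 from funext fun t => by simp [hω]]
    · simpa [hω] using not_not.1 fun h => hω (hpN h)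
  · filter_upwards [measure_eq_zero_iff_ae_notMem.1 hN0] with ω hω t
    simp [hω]

end NullSets

section VectorValued

variable {E F : Type*} [NormedAddCommGroup E] [NormedSpace ℝ E] [NormedAddCommGroup F]
  [NormedSpace ℝ F] {f : ℝ≥0 → Ω → E}

lemma stronglyAdapted_setIntegral_Iic (hf : IsStronglyProgressive 𝔽 f) :
    StronglyAdapted 𝔽 fun t ω => ∫ s in Set.Iic t, f s ω ∂timeMeasure := by
  intro t
  have hsub (ω : Ω) : ∫ s in Set.Iic t, f s ω ∂timeMeasure =
      ∫ s : Set.Iic t, f s ω ∂(timeMeasure.comap Subtype.val) :=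
    (integral_subtype_comap measurableSet_Iic fun s => f s ω).symm
  have : IsFiniteMeasure (timeMeasure.comap (Subtype.val : Set.Iic t → ℝ≥0)) := by
    refine ⟨?_⟩
    rw [(MeasurableEmbedding.subtype_coe measurableSet_Iic).comap_apply, Set.image_univ,
      Subtype.range_coe, timeMeasure_Iic]
    exact ENNReal.coe_lt_top
  simp only [hsub]
  exact @StronglyMeasurable.integral_prod_left' _ _ _ _ (𝔽 t)
    (timeMeasure.comap (Subtype.val : Set.Iic t → ℝ≥0)) _ _ _ _ (hf t)

lemma isStronglyProgressive_clm_apply {A : ℝ≥0 → Ω → E →L[ℝ] F}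
    (hA : IsStronglyProgressive 𝔽 A) (hf : IsStronglyProgressive 𝔽 f) :
    IsStronglyProgressive 𝔽 fun t ω => A t ω (f t ω) := fun t =>
  stronglyMeasurable_clm_apply (hA t) (hf t)

end VectorValued

end Measurability

section RandomPaths

variable {β Ω E : Type*} {mβ : MeasurableSpace β} {mΩ : MeasurableSpace Ω} {ν : Measure β}
  {μ : Measure Ω} [SFinite ν] [SFinite μ]

lemma ae_ae_swap_of_ae_prod {p : β × Ω → Prop} (h : ∀ᵐ z ∂ν.prod μ, p z) :
    ∀ᵐ ω ∂μ, ∀ᵐ t ∂ν, p (t, ω) :=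
  Measure.ae_ae_of_ae_prod
    ((Measure.measurePreserving_swap (μ := μ) (ν := ν)).quasiMeasurePreserving.ae h)

lemma ae_memLp_two_path [NormedAddCommGroup E] {f : β → Ω → E}
    (hf : MemLp (Function.uncurry f) 2 (ν.prod μ)) : ∀ᵐ ω ∂μ, MemLp (fun t => f t ω) 2 ν := by
  have hmeas : ∀ᵐ ω ∂μ, AEStronglyMeasurable (fun t => f t ω) ν :=
    (hf.1.prod_swap (f := Function.uncurry f)).prodMk_left
  filter_upwards [hmeas, ((memLp_two_iff_integrable_sq_norm hf.1).1 hf).prod_left_ae]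
    with ω hm hsq
  exact (memLp_two_iff_integrable_sq_norm hm).2 hsq

lemma sq_integral_le_measureReal_mul_integral_sq [IsFiniteMeasure ν] {g : β → ℝ}
    (hg : MemLp g 2 ν) : (∫ s, g s ∂ν) ^ 2 ≤ ν.real Set.univ * ∫ s, g s ^ 2 ∂ν := by
  rcases eq_zero_or_neZero ν with rfl | hν
  · simp
  have jensen := (even_two.convexOn_pow (𝕜 := ℝ)).map_average_le
    (continuous_pow 2).continuousOn isClosed_univ (ae_of_all ν fun _ => Set.mem_univ _)
    (hg.integrable one_le_two) hg.integrable_sq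
  have mass_pos : 0 < ν.real Set.univ := measureReal_univ_pos
  rw [average_eq, average_eq, smul_eq_mul, smul_eq_mul, mul_pow] at jensen
  field_simp at jensen
  exact jensen

lemma memLp_two_integral [IsFiniteMeasure ν] {g : β → Ω → ℝ}
    (hg : MemLp (Function.uncurry g) 2 (ν.prod μ)) : MemLp (fun ω => ∫ s, g s ω ∂ν) 2 μ := by
  have hmeas : AEStronglyMeasurable (fun ω => ∫ s, g s ω ∂ν) μ :=
    hg.1.prod_swap.integral_prod_right'
  refine (memLp_two_iff_integrable_sq hmeas).2
    ((hg.integrable_sq.integral_prod_right.const_mul (ν.real Set.univ)).mono' (hmeas.pow 2) ?_)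
  filter_upwards [ae_memLp_two_path hg] with ω hω
  rw [Real.norm_of_nonneg (sq_nonneg _)]
  exact sq_integral_le_measureReal_mul_integral_sq hω

end RandomPaths

section RandomODE

variable {Ω : Type*} {mΩ : MeasurableSpace Ω} {𝔽 : Filtration ℝ≥0 mΩ} {μ : Measure Ω}
  {E : Type*} [NormedAddCommGroup E] [NormedSpace ℝ E]
  {A : ℝ≥0 → Ω → E →L[ℝ] E} {C : ℝ} {f : ℝ≥0 → Ω → E} {x : E}

lemma stronglyMeasurable_path {β : Type*} [TopologicalSpace β]
    [TopologicalSpace.PseudoMetrizableSpace β] {X : ℝ≥0 → Ω → β}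
    (hX : IsStronglyProgressive 𝔽 X) (ω : Ω) : StronglyMeasurable fun s => X s ω :=
  (stronglyMeasurable_uncurry_of_isStronglyProgressive hX).comp_measurable
    measurable_prodMk_right

lemma isStronglyProgressive_picard (hA : IsStronglyProgressive 𝔽 A) (hAC : ∀ s ω, ‖A s ω‖ ≤ C)
    (hf : IsStronglyProgressive 𝔽 f)
    (hfi : ∀ ω, LocallyIntegrable (fun s => f s ω) timeMeasure) (k : ℕ) :
    IsStronglyProgressive 𝔽 fun t ω => picard (fun s => A s ω) (fun s => f s ω) x k t := by
  induction k with
  | zero => exact isStronglyProgressive_const 𝔽 x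
  | succ k ih =>
    refine StronglyAdapted.isStronglyProgressive_of_continuous (fun t => ?_) fun ω =>
      continuous_picard (stronglyMeasurable_path hA ω) (hAC · ω) (hfi ω) (k + 1)
    exact stronglyMeasurable_const.add
      (stronglyAdapted_setIntegral_Iic ((isStronglyProgressive_clm_apply hA ih).add hf) t)

lemma exists_isStronglyProgressive_isLinearODESolution [CompleteSpace E]
    (hnull : ∀ N, MeasurableSet N → μ N = 0 → MeasurableSet[𝔽 0] N)
    (hA : IsStronglyProgressive 𝔽 A) (hAC : ∀ s ω, ‖A s ω‖ ≤ C) (hf : IsStronglyProgressive 𝔽 f)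
    (hfi : ∀ᵐ ω ∂μ, LocallyIntegrable (fun s => f s ω) timeMeasure) (x : E) :
    ∃ X, IsStronglyProgressive 𝔽 X ∧
      ∀ᵐ ω ∂μ, IsLinearODESolution (fun s => A s ω) (fun s => f s ω) x fun t => X t ω := by
  obtain ⟨g, hg, hgi, hgf⟩ := exists_isStronglyProgressive_forall_of_ae hnull hf
    (p := (LocallyIntegrable · timeMeasure)) locallyIntegrable_zero hfi
  choose X hX using fun ω =>
    exists_tendsto_picard (stronglyMeasurable_path hA ω) (hAC · ω) (hgi ω) x
  have hXsol (ω : Ω) : IsLinearODESolution (fun s => A s ω) (fun s => g s ω) x (X ω) :=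
    isLinearODESolution_of_picard (stronglyMeasurable_path hA ω) (hAC · ω) (hgi ω) (hX ω)
  refine ⟨fun t ω => X ω t, ?_, ?_⟩
  · refine StronglyAdapted.isStronglyProgressive_of_continuous (fun t => ?_) fun ω =>
      (hXsol ω).continuous
    exact stronglyMeasurable_of_tendsto atTop
      (fun k => (isStronglyProgressive_picard hA hAC hg hgi k).stronglyAdapted t)
      (tendsto_pi_nhds.2 fun ω => tendsto_picard (hX ω) t)
  · filter_upwards [hgf] with ω hω
    simpa only [hω] using hXsol ω

lemma memLp_two_of_isLinearODESolution [IsFiniteMeasure μ] {X : ℝ≥0 → Ω → E}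
    (hA : IsStronglyProgressive 𝔽 A) (hAC : ∀ s ω, ‖A s ω‖ ≤ C)
    (hf : MemLp (Function.uncurry f) 2 (timeMeasure.prod μ)) (hX : IsStronglyProgressive 𝔽 X)
    (hXsol : ∀ᵐ ω ∂μ, IsLinearODESolution (fun s => A s ω) (fun s => f s ω) x fun t => X t ω)
    (T : ℝ≥0) :
    MemLp (Function.uncurry X) 2 ((timeMeasure.restrict (Set.Iic T)).prod μ) := by
  set B : Ω → ℝ := fun ω =>
    (‖x‖ + ∫ s in Set.Iic T, ‖f s ω‖ ∂timeMeasure) * Real.exp (C * T)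
  have hB : MemLp B 2 μ := ((memLp_const ‖x‖).add (memLp_two_integral (hf.mono_measure
    (Measure.prod_mono Measure.restrict_le_self le_rfl)).norm)).mul_const _
  have growth : ∀ᵐ ω ∂μ, ∀ t ≤ T, ‖X t ω‖ ≤ B ω := by
    filter_upwards [hXsol, ae_memLp_two_path hf] with ω hω hfω t ht
    have hfω := hfω.locallyIntegrable one_le_two
    have hC : 0 ≤ C := (norm_nonneg _).trans (hAC 0 ω)
    refine (hω.norm_le (stronglyMeasurable_path hA ω) (hAC · ω) hfω t).trans ?_
    exact mul_le_mul (add_le_add_right (setIntegral_norm_Iic_mono hfω ht) _)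
      (Real.exp_le_exp.2 (by gcongr)) (by positivity) (by positivity)
  refine (hB.comp_snd (timeMeasure.restrict (Set.Iic T))).mono'
    (stronglyMeasurable_uncurry_of_isStronglyProgressive hX).aestronglyMeasurable ?_
  filter_upwards [Measure.quasiMeasurePreserving_snd.ae growth,
    Measure.quasiMeasurePreserving_fst.ae (ae_restrict_mem measurableSet_Iic)] with z hz hzT
  exact hz z.1 hzT

end RandomODE

section Chain

variable {D : ℕ} {Ω : Type*} [mΩ : MeasurableSpace Ω]

lemma countable_setOf_leftLimit_ne {β : Type*} [TopologicalSpace β] [DiscreteTopology β]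
    {a l : ℝ≥0 → β} (hr : ∀ t, ContinuousWithinAt a (Set.Ici t) t)
    (hl : ∀ t, Tendsto a (𝓝[<] t) (𝓝 (l t))) : {t | l t ≠ a t}.Countable := by
  refine (countable_setOfPred_isolated_right_within (s := {t | l t ≠ a t})).mono ?_
  intro t ht
  refine ⟨ht, ?_⟩
  obtain ⟨u, htu, hu⟩ : ∃ u > t, ∀ s ∈ Set.Ico t u, a s = a t := by
    have ha : ∀ᶠ s in 𝓝[≥] t, a s = a t := by
      simpa only [nhds_discrete, tendsto_pure] using (hr t).tendsto
    exact mem_nhdsGE_iff_exists_Ico_subset.1 ha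
  rw [← empty_mem_iff_bot, mem_nhdsWithin_iff_exists_mem_nhds_inter]
  refine ⟨Set.Iio u, Iio_mem_nhds htu, ?_⟩
  rintro r ⟨hru, hrs, htr⟩
  have : (𝓝[<] r).NeBot := nhdsLT_neBot_of_exists_lt ⟨t, htr⟩
  refine hrs (tendsto_nhds_unique (hl r) (tendsto_const_nhds.congr' ?_))
  filter_upwards [Ioo_mem_nhdsLT htr] with s hs
  rw [hu s ⟨hs.1.le, hs.2.trans hru⟩, hu r ⟨le_of_lt htr, hru⟩]

section AugmentedFiltration

variable (α : ℝ≥0 → Ω → Fin D) (hα : ∀ t, Measurable (α t)) (μ : Measure Ω)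

lemma measurableSet_augFiltration_of_null {N : Set Ω} (hN : MeasurableSet N) (h0 : μ N = 0)
    (t : ℝ≥0) : MeasurableSet[augFiltration α hα μ t] N :=
  le_sup_right (a := Filtration.natural α (fun t => (hα t).stronglyMeasurable) t)
    (b := nullSigma μ) _ (MeasurableSpace.measurableSet_generateFrom ⟨hN, h0⟩)

lemma stronglyAdapted_augFiltration : StronglyAdapted (augFiltration α hα μ) α := fun t =>
  ((Filtration.stronglyAdapted_natural fun t => (hα t).stronglyMeasurable) t).mono
    (le_sup_left (b := nullSigma μ))

end AugmentedFiltration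

namespace IsMarkovChainFrom

variable {G : Matrix (Fin D) (Fin D) ℝ} {α : ℝ≥0 → Ω → Fin D} {hα : ∀ t, Measurable (α t)}
  {μ : Measure Ω} {i : Fin D} {E F : Type*} [NormedAddCommGroup E] [NormedSpace ℝ E]
  [NormedAddCommGroup F] [NormedSpace ℝ F]

lemma isStronglyProgressive_comp (hc : IsMarkovChainFrom G α hα μ i) {β : Type*}
    [TopologicalSpace β] (φ : Fin D → β) :
    IsStronglyProgressive (augFiltration α hα μ) fun t ω => φ (α t ω) := fun t =>
  continuous_of_discreteTopology.comp_stronglyMeasurable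
    (isStronglyProgressive_of_rightContinuous (stronglyAdapted_augFiltration α hα μ)
      hc.right_cont t)

lemma stronglyMeasurable_uncurry_comp (hc : IsMarkovChainFrom G α hα μ i) {β : Type*}
    [TopologicalSpace β] (φ : Fin D → β) :
    StronglyMeasurable fun z : ℝ≥0 × Ω => φ (α z.1 z.2) :=
  continuous_of_discreteTopology.comp_stronglyMeasurable
    (stronglyMeasurable_uncurry_of_isStronglyProgressive (hc.isStronglyProgressive_comp id))

lemma exists_isStronglyPredictable_ae_eq [SFinite μ] (hc : IsMarkovChainFrom G α hα μ i) :
    ∃ a : ℝ≥0 → Ω → Fin D, IsStronglyPredictable (augFiltration α hα μ) a ∧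
      ∀ᵐ z ∂timeMeasure.prod μ, a z.1 z.2 = α z.1 z.2 := by
  choose l hl using hc.left_lim
  set a : ℝ≥0 → Ω → Fin D := fun t ω => if t = 0 then α 0 ω else l ω t
  have ha : IsStronglyPredictable (augFiltration α hα μ) a :=
    isStronglyPredictable_of_tendsto_nhdsLT (stronglyAdapted_augFiltration α hα μ) (by simp [a])
      fun ω t ht => by simpa [a, ht.ne'] using hl ω t
  have ha_path (ω : Ω) : ∀ᵐ t ∂timeMeasure, a t ω = α t ω := by
    have hjumps := (countable_setOf_leftLimit_ne (hc.right_cont ω) (hl ω)).measure_zero timeMeasure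
    filter_upwards [measure_eq_zero_iff_ae_notMem.1 hjumps] with t ht
    by_cases h : t = 0
    · simp [a, h]
    · simpa [a, h] using ht
  have ha_eq : MeasurableSet {z : ℝ≥0 × Ω | a z.1 z.2 = α z.1 z.2} :=
    measurableSet_eq_fun
      (stronglyMeasurable_uncurry_of_isStronglyProgressive ha.isStronglyProgressive).measurable
      (hc.stronglyMeasurable_uncurry_comp id).measurable
  refine ⟨a, ha, (Measure.measurePreserving_swap (μ := timeMeasure)
    (ν := μ)).quasiMeasurePreserving.ae (p := fun z => a z.2 z.1 = α z.2 z.1) ?_⟩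
  exact (Measure.ae_prod_iff_ae_ae (ha_eq.preimage measurable_swap)).2 (ae_of_all _ ha_path)

lemma exists_isStronglyPredictable_apply_ae_eq [SFinite μ] [SecondCountableTopology E]
    (hc : IsMarkovChainFrom G α hα μ i) (M : Fin D → E →L[ℝ] F) {X : ℝ≥0 → Ω → E}
    (hX : IsStronglyProgressive (augFiltration α hα μ) X)
    (hXc : ∀ᵐ ω ∂μ, Continuous fun t => X t ω) :
    ∃ ψ : ℝ≥0 → Ω → F, IsStronglyPredictable (augFiltration α hα μ) ψ ∧
      Function.uncurry (fun t ω => M (α t ω) (X t ω)) =ᵐ[timeMeasure.prod μ]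
        Function.uncurry ψ := by
  obtain ⟨Y, hY, hYc, hYX⟩ := exists_isStronglyProgressive_forall_of_ae
    (fun N hN h0 => measurableSet_augFiltration_of_null α hα μ hN h0 0) hX (p := Continuous)
    continuous_zero hXc
  have hYp : IsStronglyPredictable (augFiltration α hα μ) Y :=
    isStronglyPredictable_of_tendsto_nhdsLT hY.stronglyAdapted rfl fun ω t _ =>
      ((hYc ω).tendsto t).mono_left nhdsWithin_le_nhds
  obtain ⟨a, ha, haα⟩ := hc.exists_isStronglyPredictable_ae_eq
  refine ⟨fun t ω => M (a t ω) (Y t ω), stronglyMeasurable_clm_apply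
    (continuous_of_discreteTopology.comp_stronglyMeasurable ha) hYp, ?_⟩
  filter_upwards [haα, Measure.quasiMeasurePreserving_snd.ae hYX] with z hz hYz
  simp only [Function.uncurry, hz, hYz]

end IsMarkovChainFrom

end Chain

section Dynkin

lemma hasDerivAt_exp_smul_mulVec {ι : Type*} [Fintype ι] [DecidableEq ι] (G : Matrix ι ι ℝ)
    (φ : ι → ℝ) (r : ℝ) : HasDerivAt (fun r : ℝ => NormedSpace.exp (r • G) *ᵥ φ)
      (NormedSpace.exp (r • G) *ᵥ (G *ᵥ φ)) r := by
  let : NormedRing (Matrix ι ι ℝ) := Matrix.linftyOpNormedRing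
  let : NormedAlgebra ℝ (Matrix ι ι ℝ) := Matrix.linftyOpNormedAlgebra
  let evalAt : Matrix ι ι ℝ →L[ℝ] (ι → ℝ) :=
    LinearMap.toContinuousLinearMap ((Matrix.mulVecBilin ℝ ℝ).flip φ)
  rw [Matrix.mulVec_mulVec]
  exact evalAt.hasFDerivAt.comp_hasDerivAt r (hasDerivAt_exp_smul_const (𝕂 := ℝ) G r)

lemma setIntegral_Ioc_eq_intervalIntegral {E : Type*} [NormedAddCommGroup E] [NormedSpace ℝ E]
    (f : ℝ → E) {s t : ℝ≥0} (hst : s ≤ t) :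
    ∫ r in Set.Ioc s t, f r ∂timeMeasure = ∫ r in (s : ℝ)..t, f r := by
  have hsub : Set.Ioc (s : ℝ) t ⊆ Set.Ici 0 := fun r hr => s.coe_nonneg.trans hr.1.le
  rw [intervalIntegral.integral_of_le (NNReal.coe_le_coe.2 hst),
    ← Measure.restrict_restrict_of_subset hsub, ← map_coe_timeMeasure,
    measurableEmbedding_coe_nnreal.setIntegral_map]
  rfl

lemma setIntegral_Iic_setIntegral_Ioc_swap {E : Type*} [NormedAddCommGroup E] [NormedSpace ℝ E]
    {T : ℝ≥0} {h : ℝ≥0 → ℝ≥0 → E} (hh : Integrable (Function.uncurry h)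
      ((timeMeasure.restrict (Set.Iic T)).prod (timeMeasure.restrict (Set.Iic T)))) :
    ∫ s in Set.Iic T, ∫ r in Set.Ioc s T, h s r ∂timeMeasure ∂timeMeasure =
      ∫ r in Set.Iic T, ∫ s in Set.Iic r, h s r ∂timeMeasure ∂timeMeasure := by
  have upper (s : ℝ≥0) : ∫ r in Set.Ioc s T, h s r ∂timeMeasure =
      ∫ r in Set.Iic T, (Set.Ioi s).indicator (h s) r ∂timeMeasure := by
    rw [setIntegral_indicator measurableSet_Ioi, Set.inter_comm, Set.Ioi_inter_Iic]
  have lower : ∀ r ∈ Set.Iic T, ∫ s in Set.Iic T, (Set.Ioi s).indicator (h s) r ∂timeMeasure =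
      ∫ s in Set.Iic r, h s r ∂timeMeasure := fun r hr => by
    have hind (s : ℝ≥0) : (Set.Ioi s).indicator (h s) r = (Set.Iio r).indicator (h · r) s := rfl
    simp_rw [hind]
    rw [setIntegral_indicator measurableSet_Iio, Set.inter_eq_right.2
      ((Set.Iio_subset_Iic_self).trans (Set.Iic_subset_Iic.2 hr)), integral_Iic_eq_integral_Iio]
  have triangle : MeasurableSet {z : ℝ≥0 × ℝ≥0 | z.1 < z.2} :=
    measurableSet_lt measurable_fst measurable_snd
  simp_rw [upper]
  rw [integral_integral_swap (f := fun s r => (Set.Ioi s).indicator (h s) r)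
    (hh.indicator triangle)]
  exact setIntegral_congr_fun measurableSet_Iic lower

lemma integrable_apply_mul {κ S : Type*} [Finite κ] [MeasurableSpace κ]
    [DiscreteMeasurableSpace κ] {_ : MeasurableSpace S} {ν : Measure S} {a : S → κ}
    (ha : Measurable a) (φ : κ → ℝ) {W : S → ℝ} (hW : Integrable W ν) :
    Integrable (fun z => φ (a z) * W z) ν := by
  have := Fintype.ofFinite κ
  exact hW.bdd_mul (c := ‖φ‖) ((Measurable.of_discrete (f := φ)).comp ha).aestronglyMeasurable
    (ae_of_all _ fun z => norm_le_pi_norm φ (a z))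

variable {D : ℕ} {Ω : Type*} [mΩ : MeasurableSpace Ω] {G : Matrix (Fin D) (Fin D) ℝ}
  {α : ℝ≥0 → Ω → Fin D} {hα : ∀ t, Measurable (α t)} {μ : Measure Ω} {i : Fin D}

lemma integral_apply_mul_setIntegral_eq [SFinite μ] {a : Ω → Fin D} (ha : Measurable a)
    (φ : Fin D → ℝ) {ζ : ℝ≥0 → Ω → ℝ} {t : ℝ≥0}
    (hζ : Integrable (Function.uncurry ζ) ((timeMeasure.restrict (Set.Iic t)).prod μ)) :
    ∫ ω, φ (a ω) * ∫ s in Set.Iic t, ζ s ω ∂timeMeasure ∂μ =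
      ∫ s in Set.Iic t, ∫ ω, φ (a ω) * ζ s ω ∂μ ∂timeMeasure := by
  simp_rw [← integral_const_mul]
  exact integral_integral_swap (f := fun ω s => φ (a ω) * ζ s ω)
    (integrable_apply_mul (ha.comp measurable_snd) φ hζ).swap

namespace IsMarkovChainFrom

lemma setIntegral_eq_integral_mul_exp [IsFiniteMeasure μ] (hc : IsMarkovChainFrom G α hα μ i)
    {s t : ℝ≥0} (hst : s ≤ t) (j : Fin D) {W : Ω → ℝ}
    (hWm : StronglyMeasurable[augFiltration α hα μ s] W) (hW : Integrable W μ) :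
    ∫ ω in {ω | α t ω = j}, W ω ∂μ =
      ∫ ω, W ω * NormedSpace.exp (((t : ℝ) - s) • G) (α s ω) j ∂μ := by
  have hj : MeasurableSet {ω | α t ω = j} := hα t (measurableSet_singleton j)
  have hWj : {ω | α t ω = j}.indicator W = W * {ω | α t ω = j}.indicator (fun _ => (1 : ℝ)) := by
    ext ω
    simp [Set.indicator_apply]
  have hWj_int := hWj ▸ hW.indicator hj
  rw [← integral_indicator hj, hWj, ← integral_condExp ((augFiltration α hα μ).le s)]
  refine integral_congr_ae ?_
  filter_upwards [condExp_mul_of_stronglyMeasurable_left hWm hWj_int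
    ((integrable_const 1).indicator hj), hc.markov s t hst j] with ω hpull hmarkov
  rw [hpull, Pi.mul_apply, hmarkov]

lemma integral_apply_mul_eq_exp [IsFiniteMeasure μ] (hc : IsMarkovChainFrom G α hα μ i) {s t : ℝ≥0}
    (hst : s ≤ t) (φ : Fin D → ℝ) {W : Ω → ℝ}
    (hWm : StronglyMeasurable[augFiltration α hα μ s] W) (hW : Integrable W μ) :
    ∫ ω, φ (α t ω) * W ω ∂μ =
      ∫ ω, (NormedSpace.exp (((t : ℝ) - s) • G) *ᵥ φ) (α s ω) * W ω ∂μ := by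
  set Φ := NormedSpace.exp (((t : ℝ) - s) • G)
  have hj (j : Fin D) : MeasurableSet {ω | α t ω = j} := hα t (measurableSet_singleton j)
  calc ∫ ω, φ (α t ω) * W ω ∂μ
      = ∫ ω, ∑ j, φ j * {ω | α t ω = j}.indicator W ω ∂μ := by
        simp [Set.indicator_apply]
    _ = ∑ j, φ j * ∫ ω, W ω * Φ (α s ω) j ∂μ := by
        rw [integral_finsetSum _ fun j _ => (hW.indicator (hj j)).const_mul _]
        simp_rw [integral_const_mul, integral_indicator (hj _),
          hc.setIntegral_eq_integral_mul_exp hst _ hWm hW, Φ]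
    _ = ∫ ω, (Φ *ᵥ φ) (α s ω) * W ω ∂μ := by
        simp_rw [← integral_const_mul, mul_comm (W _)]
        rw [← integral_finsetSum _ fun j _ =>
          (integrable_apply_mul (hα s) (Φ · j) hW).const_mul _]
        refine integral_congr_ae (ae_of_all _ fun ω => ?_)
        simp only [Matrix.mulVec, dotProduct, Finset.sum_mul]
        exact Finset.sum_congr rfl fun j _ => by ring

lemma integral_apply_mul_eq_add [IsFiniteMeasure μ] (hc : IsMarkovChainFrom G α hα μ i)
    {s t : ℝ≥0} (hst : s ≤ t) (φ : Fin D → ℝ) {W : Ω → ℝ}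
    (hWm : StronglyMeasurable[augFiltration α hα μ s] W) (hW : Integrable W μ) :
    ∫ ω, φ (α t ω) * W ω ∂μ = ∫ ω, φ (α s ω) * W ω ∂μ +
      ∫ r in Set.Ioc s t, ∫ ω, (G *ᵥ φ) (α r ω) * W ω ∂μ ∂timeMeasure := by
  let pairing : (Fin D → ℝ) →L[ℝ] ℝ := LinearMap.toContinuousLinearMap
    { toFun := fun ψ => ∫ ω, ψ (α s ω) * W ω ∂μ
      map_add' := fun ψ χ => by
        simp only [Pi.add_apply, add_mul]
        exact integral_add (integrable_apply_mul (hα s) ψ hW) (integrable_apply_mul (hα s) χ hW)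
      map_smul' := fun c ψ => by
        simp only [Pi.smul_apply, smul_eq_mul, mul_assoc, RingHom.id_apply, integral_const_mul] }
  have semigroup (r : ℝ≥0) (hr : s ≤ r) (ψ : Fin D → ℝ) : ∫ ω, ψ (α r ω) * W ω ∂μ =
      pairing (NormedSpace.exp (((r : ℝ) - s) • G) *ᵥ ψ) :=
    hc.integral_apply_mul_eq_exp hr ψ hWm hW
  have deriv (ψ : Fin D → ℝ) (r : ℝ) :
      HasDerivAt (fun r : ℝ => pairing (NormedSpace.exp ((r - s) • G) *ᵥ ψ))
        (pairing (NormedSpace.exp ((r - s) • G) *ᵥ (G *ᵥ ψ))) r :=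
    pairing.hasFDerivAt.comp_hasDerivAt r
      ((hasDerivAt_exp_smul_mulVec G ψ (r - s)).comp_sub_const r s)
  have cont (ψ : Fin D → ℝ) : Continuous fun r : ℝ =>
      pairing (NormedSpace.exp ((r - s) • G) *ᵥ ψ) :=
    continuous_iff_continuousAt.2 fun r => (deriv ψ r).continuousAt
  rw [setIntegral_congr_fun measurableSet_Ioc fun r hr => semigroup r hr.1.le (G *ᵥ φ),
    setIntegral_Ioc_eq_intervalIntegral
      (fun r => pairing (NormedSpace.exp ((r - s) • G) *ᵥ (G *ᵥ φ))) hst,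
    intervalIntegral.integral_eq_sub_of_hasDerivAt (fun r _ => deriv φ r)
      ((cont _).intervalIntegrable _ _), semigroup t hst φ, semigroup s le_rfl φ]
  ring

lemma integral_apply_eq_add [IsProbabilityMeasure μ] (hc : IsMarkovChainFrom G α hα μ i)
    (φ : Fin D → ℝ) (t : ℝ≥0) :
    ∫ ω, φ (α t ω) ∂μ = φ i + ∫ r in Set.Iic t, ∫ ω, (G *ᵥ φ) (α r ω) ∂μ ∂timeMeasure := by
  have init : ∫ ω, φ (α 0 ω) ∂μ = φ i := by
    rw [integral_congr_ae (hc.init.mono fun ω hω => congrArg φ hω), integral_const,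
      probReal_univ, one_smul]
  have h := hc.integral_apply_mul_eq_add (zero_le (a := t)) φ stronglyMeasurable_one
    (integrable_const (1 : ℝ))
  simp only [Pi.one_apply, mul_one] at h
  rw [h, init, ← integral_Icc_eq_integral_Ioc, ← bot_eq_zero, Set.Icc_bot]

lemma integrable_apply_mul_uncurry (hc : IsMarkovChainFrom G α hα μ i) (φ : Fin D → ℝ)
    {ζ : ℝ≥0 → Ω → ℝ} {ν : Measure (ℝ≥0 × Ω)} (hζ : Integrable (Function.uncurry ζ) ν) :
    Integrable (fun z => φ (α z.1 z.2) * ζ z.1 z.2) ν :=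
  integrable_apply_mul (hc.stronglyMeasurable_uncurry_comp id).measurable φ hζ

lemma integrable_integral_apply_mul [SFinite μ] (hc : IsMarkovChainFrom G α hα μ i)
    (φ : Fin D → ℝ) {ζ : ℝ≥0 → Ω → ℝ} {T : ℝ≥0}
    (hζ : Integrable (Function.uncurry ζ) ((timeMeasure.restrict (Set.Iic T)).prod μ)) :
    Integrable (Function.uncurry fun s r => ∫ ω, φ (α r ω) * ζ s ω ∂μ)
      ((timeMeasure.restrict (Set.Iic T)).prod (timeMeasure.restrict (Set.Iic T))) := by
  set ν := timeMeasure.restrict (Set.Iic T)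
  have hα_lift : Measurable fun z : ℝ≥0 × ℝ≥0 × Ω => α z.1 z.2.2 :=
    (hc.stronglyMeasurable_uncurry_comp id).measurable.comp
      (measurable_fst.prodMk measurable_snd.snd)
  have h_triple : Integrable (fun z : ℝ≥0 × ℝ≥0 × Ω => φ (α z.1 z.2.2) * ζ z.2.1 z.2.2)
      (ν.prod (ν.prod μ)) := integrable_apply_mul hα_lift φ (hζ.comp_snd ν)
  exact ((measurePreserving_prodAssoc ν ν μ).integrable_comp_of_integrable
    h_triple).integral_prod_left.swap

lemma integral_apply_mul_setIntegral_eq_add [IsFiniteMeasure μ]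
    (hc : IsMarkovChainFrom G α hα μ i) (φ : Fin D → ℝ) {ζ : ℝ≥0 → Ω → ℝ} {T : ℝ≥0}
    (hζ : IsStronglyProgressive (augFiltration α hα μ) ζ)
    (hζi : Integrable (Function.uncurry ζ) ((timeMeasure.restrict (Set.Iic T)).prod μ)) :
    ∫ ω, φ (α T ω) * ∫ s in Set.Iic T, ζ s ω ∂timeMeasure ∂μ =
      ∫ s in Set.Iic T, ∫ ω, φ (α s ω) * ζ s ω ∂μ ∂timeMeasure +
      ∫ r in Set.Iic T, ∫ ω, (G *ᵥ φ) (α r ω) * ∫ s in Set.Iic r, ζ s ω ∂timeMeasure ∂μ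
        ∂timeMeasure := by
  have increment : ∀ᵐ s ∂timeMeasure.restrict (Set.Iic T),
      ∫ ω, φ (α T ω) * ζ s ω ∂μ - ∫ ω, φ (α s ω) * ζ s ω ∂μ =
        ∫ r in Set.Ioc s T, ∫ ω, (G *ᵥ φ) (α r ω) * ζ s ω ∂μ ∂timeMeasure := by
    filter_upwards [ae_restrict_mem measurableSet_Iic, hζi.prod_right_ae] with s hs hζs
    rw [hc.integral_apply_mul_eq_add hs φ (hζ.stronglyAdapted s) hζs, add_sub_cancel_left]
  have fubini : ∀ r ∈ Set.Iic T,
      ∫ ω, (G *ᵥ φ) (α r ω) * ∫ s in Set.Iic r, ζ s ω ∂timeMeasure ∂μ =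
        ∫ s in Set.Iic r, ∫ ω, (G *ᵥ φ) (α r ω) * ζ s ω ∂μ ∂timeMeasure := fun r hr =>
    integral_apply_mul_setIntegral_eq (hα r) (G *ᵥ φ) <| hζi.mono_measure <|
      Measure.prod_mono (Measure.restrict_mono (Set.Iic_subset_Iic.2 hr) le_rfl) le_rfl
  have hφT : Integrable (fun s => ∫ ω, φ (α T ω) * ζ s ω ∂μ) (timeMeasure.restrict (Set.Iic T)) :=
    (integrable_apply_mul ((hα T).comp measurable_snd) φ hζi).integral_prod_left
  rw [integral_apply_mul_setIntegral_eq (hα T) φ hζi, ← sub_eq_iff_eq_add',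
    ← integral_sub hφT (hc.integrable_apply_mul_uncurry φ hζi).integral_prod_left,
    integral_congr_ae increment,
    setIntegral_Iic_setIntegral_Ioc_swap (hc.integrable_integral_apply_mul (G *ᵥ φ) hζi)]
  exact (setIntegral_congr_fun measurableSet_Iic fubini).symm

lemma integral_apply_mul_eq_of_primitive [IsProbabilityMeasure μ]
    (hc : IsMarkovChainFrom G α hα μ i) (φ : Fin D → ℝ) {z : ℝ} {ζ Z : ℝ≥0 → Ω → ℝ} {T : ℝ≥0}
    (hζ : IsStronglyProgressive (augFiltration α hα μ) ζ)
    (hζi : Integrable (Function.uncurry ζ) ((timeMeasure.restrict (Set.Iic T)).prod μ))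
    (hZ : ∀ᵐ ω ∂μ, ∀ t, Z t ω = z + ∫ s in Set.Iic t, ζ s ω ∂timeMeasure)
    (hZi : Integrable (Function.uncurry Z) ((timeMeasure.restrict (Set.Iic T)).prod μ)) :
    ∫ ω, φ (α T ω) * Z T ω ∂μ = φ i * z +
      ∫ y, (φ (α y.1 y.2) * ζ y.1 y.2 + (G *ᵥ φ) (α y.1 y.2) * Z y.1 y.2)
        ∂(timeMeasure.restrict (Set.Iic T)).prod μ := by
  set ν := timeMeasure.restrict (Set.Iic T)
  have split (ψ : Fin D → ℝ) : ∀ t ∈ Set.Iic T, ∫ ω, ψ (α t ω) * Z t ω ∂μ =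
      (∫ ω, ψ (α t ω) ∂μ) * z + ∫ ω, ψ (α t ω) * ∫ s in Set.Iic t, ζ s ω ∂timeMeasure ∂μ := by
    intro t ht
    have h_const : Integrable (fun ω => ψ (α t ω) * z) μ :=
      integrable_apply_mul (hα t) ψ (integrable_const z)
    have h_prim : Integrable (fun ω => ψ (α t ω) * ∫ s in Set.Iic t, ζ s ω ∂timeMeasure) μ :=
      integrable_apply_mul (hα t) ψ (hζi.mono_measure (Measure.prod_mono
        (Measure.restrict_mono (Set.Iic_subset_Iic.2 ht) le_rfl) le_rfl)).integral_prod_right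
    rw [← integral_mul_const, ← integral_add h_const h_prim]
    exact integral_congr_ae (hZ.mono fun ω hω => by simp only [hω, mul_add])
  have hφζ := hc.integrable_apply_mul_uncurry φ hζi
  have hGZ := hc.integrable_apply_mul_uncurry (G *ᵥ φ) hZi
  have hG : Integrable (fun s => ∫ ω, (G *ᵥ φ) (α s ω) ∂μ) ν := by
    simpa using (hc.integrable_apply_mul_uncurry (G *ᵥ φ) (ζ := fun _ _ => 1)
      (integrable_const (μ := ν.prod μ) (1 : ℝ))).integral_prod_left
  have generator : ∫ s, ∫ ω, (G *ᵥ φ) (α s ω) * ∫ r in Set.Iic s, ζ r ω ∂timeMeasure ∂μ ∂ν =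
      ∫ s, ∫ ω, (G *ᵥ φ) (α s ω) * Z s ω ∂μ ∂ν - (∫ s, ∫ ω, (G *ᵥ φ) (α s ω) ∂μ ∂ν) * z := by
    rw [← integral_mul_const, ← integral_sub hGZ.integral_prod_left (hG.mul_const z)]
    exact setIntegral_congr_fun measurableSet_Iic fun s hs => by simp only [split _ s hs]; ring
  rw [split φ T Set.self_mem_Iic, hc.integral_apply_eq_add φ T,
    hc.integral_apply_mul_setIntegral_eq_add φ hζ hζi, generator, integral_add hφζ hGZ,
    integral_prod _ hφζ, integral_prod _ hGZ]
  ring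

end IsMarkovChainFrom

end Dynkin

section QuadraticForms

variable {ι κ : Type*} [Fintype ι]

lemma transpose_mulVec_dotProduct [Fintype κ] (M : Matrix ι κ ℝ) (y : ι → ℝ) (w : κ → ℝ) :
    (Mᵀ *ᵥ y) ⬝ᵥ w = (M *ᵥ w) ⬝ᵥ y := by
  rw [Matrix.mulVec_transpose, ← Matrix.dotProduct_mulVec, dotProduct_comm]

lemma dotProduct_mulVec_eq_sum (M : Matrix ι ι ℝ) (u v : ι → ℝ) :
    u ⬝ᵥ M *ᵥ v = ∑ k, ∑ l, M k l * (u k * v l) := by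
  simp only [dotProduct, Matrix.mulVec, Finset.mul_sum, mul_left_comm]

lemma abs_dotProduct_mulVec_le (M : Matrix ι ι ℝ) (u v : ι → ℝ) :
    |u ⬝ᵥ M *ᵥ v| ≤ (∑ k, ∑ l, |M k l|) * (‖u‖ * ‖v‖) := by
  simp only [dotProduct_mulVec_eq_sum, Finset.sum_mul]
  refine (Finset.abs_sum_le_sum_abs _ _).trans (Finset.sum_le_sum fun k _ => ?_)
  refine (Finset.abs_sum_le_sum_abs _ _).trans (Finset.sum_le_sum fun l _ => ?_)
  rw [abs_mul, abs_mul]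
  gcongr
  exacts [norm_le_pi_norm u k, norm_le_pi_norm v l]

lemma exists_forall_mul_sq_norm_le_of_posDef [Finite κ] {M : κ → Matrix ι ι ℝ}
    (hM : ∀ j, (M j).PosDef) : ∃ c > 0, ∀ j v, c * ‖v‖ ^ 2 ≤ v ⬝ᵥ M j *ᵥ v := by
  let : TopologicalSpace κ := ⊥
  have : DiscreteTopology κ := ⟨rfl⟩
  have hcont : Continuous fun z : κ × (ι → ℝ) => z.2 ⬝ᵥ M z.1 *ᵥ z.2 :=
    continuous_snd.dotProduct ((continuous_of_discreteTopology.comp continuous_fst).matrix_mulVec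
      continuous_snd)
  have hpos : ∀ z ∈ Set.univ ×ˢ Metric.sphere (0 : ι → ℝ) 1, 0 < z.2 ⬝ᵥ M z.1 *ᵥ z.2 :=
    fun z hz => by
      simpa using (hM z.1).dotProduct_mulVec_pos (ne_zero_of_mem_unit_sphere ⟨z.2, hz.2⟩)
  obtain ⟨c, hc, hcM⟩ := (isCompact_univ.prod (isCompact_sphere (0 : ι → ℝ) 1)).exists_forall_le'
    hcont.continuousOn hpos
  refine ⟨c, hc, fun j v => ?_⟩
  rcases eq_or_ne v 0 with rfl | hv
  · simp
  have hunit : c ≤ (‖v‖⁻¹ • v) ⬝ᵥ M j *ᵥ (‖v‖⁻¹ • v) :=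
    hcM (j, ‖v‖⁻¹ • v) ⟨trivial, by simp [norm_smul, hv]⟩
  rw [Matrix.mulVec_smul, smul_dotProduct, dotProduct_smul, smul_smul, smul_eq_mul, ← sq,
    inv_pow, inv_mul_eq_div] at hunit
  exact (le_div_iff₀ (by positivity)).1 hunit

/-- The drift of `⟨P(α)Y, Y⟩` along `dY = g dt` when the chain, of generator `G`, is in state
`j`. -/
def quadraticDrift [Fintype κ] (G : Matrix κ κ ℝ) (P : κ → Matrix ι ι ℝ) (j : κ) (Y g : ι → ℝ) :
    ℝ :=
  g ⬝ᵥ P j *ᵥ Y + Y ⬝ᵥ P j *ᵥ g + Y ⬝ᵥ (∑ j', G j j' • P j') *ᵥ Y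

variable [Fintype κ] {G : Matrix κ κ ℝ} {P : κ → Matrix ι ι ℝ}

lemma quadraticDrift_eq_sum (j : κ) (Y g : ι → ℝ) : quadraticDrift G P j Y g =
    ∑ k, ∑ l, (P j k l * (g k * Y l + Y k * g l) + (G *ᵥ (P · k l)) j * (Y k * Y l)) := by
  simp only [quadraticDrift, dotProduct_mulVec_eq_sum, ← Finset.sum_add_distrib, mul_add]
  simp only [Matrix.sum_apply, Matrix.smul_apply, smul_eq_mul, Matrix.mulVec, dotProduct]

lemma quadraticDrift_affine (a : Matrix ι ι ℝ) (j : κ) (Y f : ι → ℝ) :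
    quadraticDrift G P j Y (a *ᵥ Y + f) =
      -(Y ⬝ᵥ (-(P j * a + aᵀ * P j + ∑ j', G j j' • P j')) *ᵥ Y) +
        (f ⬝ᵥ P j *ᵥ Y + Y ⬝ᵥ P j *ᵥ f) := by
  have transpose : (a *ᵥ Y) ⬝ᵥ P j *ᵥ Y = Y ⬝ᵥ (aᵀ * P j) *ᵥ Y := by
    rw [← Matrix.mulVec_mulVec, dotProduct_comm Y, transpose_mulVec_dotProduct]
  simp only [quadraticDrift, add_dotProduct, transpose, Matrix.mulVec_add, dotProduct_add,
    Matrix.neg_mulVec, dotProduct_neg, Matrix.add_mulVec, Matrix.mulVec_mulVec]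
  ring

lemma exists_quadraticDrift_affine_le {a : κ → Matrix ι ι ℝ}
    (hM : ∀ j, (-(P j * a j + (a j)ᵀ * P j + ∑ j', G j j' • P j')).PosDef) :
    ∃ c > 0, ∃ C ≥ 0, ∀ j Y f,
      quadraticDrift G P j Y (a j *ᵥ Y + f) ≤ -c * ‖Y‖ ^ 2 + C * ‖f‖ ^ 2 := by
  obtain ⟨c, hc, hcoercive⟩ := exists_forall_mul_sq_norm_le_of_posDef hM
  set K := ∑ j, ∑ k, ∑ l, |P j k l|
  have cross (j : κ) (u v : ι → ℝ) : u ⬝ᵥ P j *ᵥ v ≤ K * (‖u‖ * ‖v‖) := by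
    refine (le_abs_self _).trans ((abs_dotProduct_mulVec_le _ u v).trans ?_)
    gcongr
    exact Finset.single_le_sum (f := fun j => ∑ k, ∑ l, |P j k l|) (fun _ _ => by positivity)
      (Finset.mem_univ j)
  have young (p r : ℝ) : 2 * (K * (p * r)) ≤ c / 2 * r ^ 2 + 2 * K ^ 2 / c * p ^ 2 := by
    have : 0 ≤ (c * r - 2 * K * p) ^ 2 / (2 * c) := by positivity
    calc 2 * (K * (p * r)) ≤ 2 * (K * (p * r)) + (c * r - 2 * K * p) ^ 2 / (2 * c) := by linarith
      _ = c / 2 * r ^ 2 + 2 * K ^ 2 / c * p ^ 2 := by field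
  refine ⟨c / 2, by positivity, 2 * K ^ 2 / c, by positivity, fun j Y f => ?_⟩
  rw [quadraticDrift_affine]
  linarith [hcoercive j Y, cross j f Y, cross j Y f, young ‖f‖ ‖Y‖, mul_comm ‖Y‖ ‖f‖]

end QuadraticForms

noncomputable section Stability

section MulVec

variable {ι κ : Type*} [Fintype ι]

/-- Multiplication of vectors by a fixed matrix, as a continuous linear map, so that the matrix
state equation becomes a linear equation in the sense of `IsLinearODESolution`. -/
def mulVecCLM (M : Matrix κ ι ℝ) : (ι → ℝ) →L[ℝ] (κ → ℝ) :=
  LinearMap.toContinuousLinearMap M.mulVecLin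

@[simp]
lemma mulVecCLM_apply (M : Matrix κ ι ℝ) (v : ι → ℝ) : mulVecCLM M v = M *ᵥ v := rfl

end MulVec

lemma memLp_two_of_forall_integral_sq_norm_Iic_le {Ω E : Type*} {mΩ : MeasurableSpace Ω}
    {μ : Measure Ω} [SFinite μ] [NormedAddCommGroup E] {X : ℝ≥0 × Ω → E} {K : ℝ}
    (hX : AEStronglyMeasurable X (timeMeasure.prod μ))
    (hXT : ∀ T, MemLp X 2 ((timeMeasure.restrict (Set.Iic T)).prod μ))
    (hK : ∀ T, ∫ z, ‖X z‖ ^ 2 ∂(timeMeasure.restrict (Set.Iic T)).prod μ ≤ K) :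
    MemLp X 2 (timeMeasure.prod μ) := by
  have exhaustion : AECover (timeMeasure.prod μ) (atTop : Filter ℕ)
      fun k => Set.Iic (k : ℝ≥0) ×ˢ (Set.univ : Set Ω) := by
    refine ⟨ae_of_all _ fun z => ?_, fun k => measurableSet_Iic.prod MeasurableSet.univ⟩
    obtain ⟨N, hN⟩ := exists_nat_ge z.1
    filter_upwards [eventually_ge_atTop N] with k hk
    exact ⟨hN.trans (Nat.cast_le.2 hk), trivial⟩
  have restrict_eq (T : ℝ≥0) : (timeMeasure.prod μ).restrict (Set.Iic T ×ˢ Set.univ) =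
      (timeMeasure.restrict (Set.Iic T)).prod μ := by
    rw [← Measure.prod_restrict, Measure.restrict_univ]
  refine (memLp_two_iff_integrable_sq_norm hX).2
    (exhaustion.integrable_of_integral_norm_bounded K (fun k => ?_) (.of_forall fun k => ?_))
  · rw [IntegrableOn, restrict_eq]
    exact (memLp_two_iff_integrable_sq_norm (hXT k).1).1 (hXT k)
  · simpa only [restrict_eq, norm_pow, norm_norm] using hK k

section EnergyIdentity

variable {ι : Type*} [Fintype ι]

lemma apply_mul_apply_eq_of_primitive {x : ι → ℝ} {g X : ℝ≥0 → ι → ℝ}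
    (hg : LocallyIntegrable g timeMeasure)
    (hX : ∀ t, X t = x + ∫ s in Set.Iic t, g s ∂timeMeasure) (k l : ι) (t : ℝ≥0) :
    X t k * X t l =
      x k * x l + ∫ s in Set.Iic t, (g s k * X s l + X s k * g s l) ∂timeMeasure := by
  have hg_apply (k : ι) (t : ℝ≥0) : IntegrableOn (fun s => g s k) (Set.Iic t) timeMeasure :=
    (locallyIntegrable_iff_integrableOn_Iic.1 hg t).eval k
  have hX_apply (k : ι) (t : ℝ≥0) : X t k = x k + ∫ s in Set.Iic t, g s k ∂timeMeasure := by
    rw [hX, Pi.add_apply, eval_integral fun k => hg_apply k t]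
  simp only [hX_apply]
  exact setIntegral_Iic_primitive_mul_primitive
    (locallyIntegrable_iff_integrableOn_Iic.2 (hg_apply k))
    (locallyIntegrable_iff_integrableOn_Iic.2 (hg_apply l)) (x k) (x l) t

end EnergyIdentity

namespace IsMarkovChainFrom

variable {D : ℕ} {ι Ω : Type*} [Fintype ι] [mΩ : MeasurableSpace Ω]
  {G : Matrix (Fin D) (Fin D) ℝ} {α : ℝ≥0 → Ω → Fin D} {hα : ∀ t, Measurable (α t)}
  {μ : Measure Ω} {i : Fin D}

lemma memLp_clm_apply {E F : Type*} [NormedAddCommGroup E] [NormedSpace ℝ E]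
    [NormedAddCommGroup F] [NormedSpace ℝ F] (hc : IsMarkovChainFrom G α hα μ i)
    (M : Fin D → E →L[ℝ] F) {p : ℝ≥0∞} {ν : Measure (ℝ≥0 × Ω)} {Y : ℝ≥0 → Ω → E}
    (hY : MemLp (Function.uncurry Y) p ν) :
    MemLp (Function.uncurry fun t ω => M (α t ω) (Y t ω)) p ν := by
  obtain ⟨C, hC⟩ := Finite.exists_le fun j => ‖M j‖
  exact hY.of_le_mul (isBoundedBilinearMap_apply.continuous.comp_aestronglyMeasurable
    ((hc.stronglyMeasurable_uncurry_comp M).aestronglyMeasurable.prodMk hY.1))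
    (ae_of_all _ fun z => (M (α z.1 z.2)).le_of_opNorm_le (hC _) _)

section EnergyIdentity

variable {g X : ℝ≥0 → Ω → ι → ℝ} {x : ι → ℝ} {T : ℝ≥0}

lemma integrable_quadraticDrift_entry (hc : IsMarkovChainFrom G α hα μ i)
    (P : Fin D → Matrix ι ι ℝ)
    (hXL : MemLp (Function.uncurry X) 2 ((timeMeasure.restrict (Set.Iic T)).prod μ))
    (hgL : MemLp (Function.uncurry g) 2 ((timeMeasure.restrict (Set.Iic T)).prod μ)) (k l : ι) :
    Integrable (fun z : ℝ≥0 × Ω => P (α z.1 z.2) k l *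
        (g z.1 z.2 k * X z.1 z.2 l + X z.1 z.2 k * g z.1 z.2 l) +
      (G *ᵥ (P · k l)) (α z.1 z.2) * (X z.1 z.2 k * X z.1 z.2 l))
      ((timeMeasure.restrict (Set.Iic T)).prod μ) :=
  (hc.integrable_apply_mul_uncurry (P · k l)
    (ζ := fun t ω => g t ω k * X t ω l + X t ω k * g t ω l)
    (((hgL.eval k).integrable_mul (hXL.eval l)).add
      ((hXL.eval k).integrable_mul (hgL.eval l)))).add
  (hc.integrable_apply_mul_uncurry (G *ᵥ (P · k l)) (ζ := fun t ω => X t ω k * X t ω l)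
    ((hXL.eval k).integrable_mul (hXL.eval l)))

lemma integrable_quadraticDrift (hc : IsMarkovChainFrom G α hα μ i) (P : Fin D → Matrix ι ι ℝ)
    (hXL : MemLp (Function.uncurry X) 2 ((timeMeasure.restrict (Set.Iic T)).prod μ))
    (hgL : MemLp (Function.uncurry g) 2 ((timeMeasure.restrict (Set.Iic T)).prod μ)) :
    Integrable (fun z : ℝ≥0 × Ω => quadraticDrift G P (α z.1 z.2) (X z.1 z.2) (g z.1 z.2))
      ((timeMeasure.restrict (Set.Iic T)).prod μ) := by
  simp only [quadraticDrift_eq_sum]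
  exact integrable_finsetSum _ fun k _ => integrable_finsetSum _ fun l _ =>
    hc.integrable_quadraticDrift_entry P hXL hgL k l

lemma integral_dotProduct_mulVec_eq [IsProbabilityMeasure μ] (hc : IsMarkovChainFrom G α hα μ i)
    (P : Fin D → Matrix ι ι ℝ)
    (hX : IsStronglyProgressive (augFiltration α hα μ) X)
    (hg : IsStronglyProgressive (augFiltration α hα μ) g)
    (hXL : MemLp (Function.uncurry X) 2 ((timeMeasure.restrict (Set.Iic T)).prod μ))
    (hgL : MemLp (Function.uncurry g) 2 ((timeMeasure.restrict (Set.Iic T)).prod μ))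
    (hgi : ∀ᵐ ω ∂μ, LocallyIntegrable (fun s => g s ω) timeMeasure)
    (hXg : ∀ᵐ ω ∂μ, ∀ t, X t ω = x + ∫ s in Set.Iic t, g s ω ∂timeMeasure) :
    ∫ ω, X T ω ⬝ᵥ P (α T ω) *ᵥ X T ω ∂μ = x ⬝ᵥ P i *ᵥ x +
      ∫ z, quadraticDrift G P (α z.1 z.2) (X z.1 z.2) (g z.1 z.2)
        ∂(timeMeasure.restrict (Set.Iic T)).prod μ := by
  have eval {Y : ℝ≥0 → Ω → ι → ℝ} (hY : IsStronglyProgressive (augFiltration α hα μ) Y)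
      (k : ι) : IsStronglyProgressive (augFiltration α hα μ) fun t ω => Y t ω k :=
    fun t => (continuous_apply k).comp_stronglyMeasurable (hY t)
  have hζ (k l : ι) : IsStronglyProgressive (augFiltration α hα μ)
      fun t ω => g t ω k * X t ω l + X t ω k * g t ω l :=
    ((eval hg k).mul (eval hX l)).add ((eval hX k).mul (eval hg l))
  have hζi (k l : ι) : Integrable
      (Function.uncurry fun t ω => g t ω k * X t ω l + X t ω k * g t ω l)
      ((timeMeasure.restrict (Set.Iic T)).prod μ) :=
    ((hgL.eval k).integrable_mul (hXL.eval l)).add ((hXL.eval k).integrable_mul (hgL.eval l))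
  have hZ (k l : ι) : ∀ᵐ ω ∂μ, ∀ t, X t ω k * X t ω l = x k * x l +
      ∫ s in Set.Iic t, (g s ω k * X s ω l + X s ω k * g s ω l) ∂timeMeasure := by
    filter_upwards [hgi, hXg] with ω hgω hXω t
    exact apply_mul_apply_eq_of_primitive hgω hXω k l t
  have hZT (k l : ι) : Integrable (fun ω => P (α T ω) k l * (X T ω k * X T ω l)) μ :=
    integrable_apply_mul (hα T) (P · k l) (((integrable_const (x k * x l)).add
      (hζi k l).integral_prod_right).congr ((hZ k l).mono fun ω h => (h T).symm))
  have dynkin (k l : ι) := hc.integral_apply_mul_eq_of_primitive (P · k l) (hζ k l) (hζi k l)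
    (hZ k l) ((hXL.eval k).integrable_mul (hXL.eval l))
  have hdrift := hc.integrable_quadraticDrift_entry P hXL hgL
  simp only [dotProduct_mulVec_eq_sum, quadraticDrift_eq_sum]
  simp only [integral_finsetSum _ fun k _ => integrable_finsetSum _ fun l _ => hZT k l,
    integral_finsetSum _ fun l _ => hZT _ l,
    integral_finsetSum _ fun k _ => integrable_finsetSum _ fun l _ => hdrift k l,
    integral_finsetSum _ fun l _ => hdrift _ l, dynkin]
  simp only [Finset.sum_add_distrib]

end EnergyIdentity

section Lyapunov

variable [IsProbabilityMeasure μ] {a P : Fin D → Matrix ι ι ℝ} {f X : ℝ≥0 → Ω → ι → ℝ}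
  {x : ι → ℝ}

lemma memLp_two_Iic_of_isLinearODESolution (hc : IsMarkovChainFrom G α hα μ i)
    (hfL : MemLp (Function.uncurry f) 2 (timeMeasure.prod μ))
    (hX : IsStronglyProgressive (augFiltration α hα μ) X)
    (hXsol : ∀ᵐ ω ∂μ, IsLinearODESolution (fun s => mulVecCLM (a (α s ω))) (fun s => f s ω) x
      fun t => X t ω) (T : ℝ≥0) :
    MemLp (Function.uncurry X) 2 ((timeMeasure.restrict (Set.Iic T)).prod μ) := by
  obtain ⟨C, hC⟩ := Finite.exists_le fun j => ‖mulVecCLM (a j)‖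
  exact memLp_two_of_isLinearODESolution (hc.isStronglyProgressive_comp fun j => mulVecCLM (a j))
    (fun s ω => hC (α s ω)) hfL hX hXsol T

lemma integral_dotProduct_mulVec_eq_of_isLinearODESolution (hc : IsMarkovChainFrom G α hα μ i)
    (P : Fin D → Matrix ι ι ℝ) (hf : IsStronglyProgressive (augFiltration α hα μ) f)
    (hfL : MemLp (Function.uncurry f) 2 (timeMeasure.prod μ))
    (hX : IsStronglyProgressive (augFiltration α hα μ) X)
    (hXsol : ∀ᵐ ω ∂μ, IsLinearODESolution (fun s => mulVecCLM (a (α s ω))) (fun s => f s ω) x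
      fun t => X t ω) (T : ℝ≥0) :
    Integrable (fun z : ℝ≥0 × Ω => quadraticDrift G P (α z.1 z.2) (X z.1 z.2)
        (a (α z.1 z.2) *ᵥ X z.1 z.2 + f z.1 z.2)) ((timeMeasure.restrict (Set.Iic T)).prod μ) ∧
      ∫ ω, X T ω ⬝ᵥ P (α T ω) *ᵥ X T ω ∂μ = x ⬝ᵥ P i *ᵥ x +
        ∫ z, quadraticDrift G P (α z.1 z.2) (X z.1 z.2) (a (α z.1 z.2) *ᵥ X z.1 z.2 + f z.1 z.2)
          ∂(timeMeasure.restrict (Set.Iic T)).prod μ := by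
  set g : ℝ≥0 → Ω → ι → ℝ := fun t ω => a (α t ω) *ᵥ X t ω + f t ω
  have hA := hc.isStronglyProgressive_comp fun j => mulVecCLM (a j)
  obtain ⟨C, hC⟩ := Finite.exists_le fun j => ‖mulVecCLM (a j)‖
  have hg : IsStronglyProgressive (augFiltration α hα μ) g :=
    (isStronglyProgressive_clm_apply hA hX).add hf
  have hXL := hc.memLp_two_Iic_of_isLinearODESolution hfL hX hXsol T
  have hgL : MemLp (Function.uncurry g) 2 ((timeMeasure.restrict (Set.Iic T)).prod μ) :=
    (hc.memLp_clm_apply (fun j => mulVecCLM (a j)) hXL).add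
      (hfL.mono_measure (Measure.prod_mono Measure.restrict_le_self le_rfl))
  have hgi : ∀ᵐ ω ∂μ, LocallyIntegrable (fun s => g s ω) timeMeasure := by
    filter_upwards [hXsol, ae_memLp_two_path hfL] with ω hω hfω
    exact (locallyIntegrable_clm_apply (stronglyMeasurable_path hA ω) (fun s => hC (α s ω))
      hω.continuous).add (hfω.locallyIntegrable one_le_two)
  have hXg : ∀ᵐ ω ∂μ, ∀ t, X t ω = x + ∫ s in Set.Iic t, g s ω ∂timeMeasure :=
    hXsol.mono fun ω hω => hω.eq_add_integral
  have drift_integrable := hc.integrable_quadraticDrift P hXL hgL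
  have energy := hc.integral_dotProduct_mulVec_eq P hX hg hXL hgL hgi hXg
  exact ⟨drift_integrable, energy⟩

theorem memLp_two_of_lyapunov (hc : IsMarkovChainFrom G α hα μ i) (hP : ∀ j, (P j).PosDef)
    (hLyapunov : ∀ j, (-(P j * a j + (a j)ᵀ * P j + ∑ j', G j j' • P j')).PosDef)
    (hf : IsStronglyProgressive (augFiltration α hα μ) f)
    (hfL : MemLp (Function.uncurry f) 2 (timeMeasure.prod μ))
    (hX : IsStronglyProgressive (augFiltration α hα μ) X)
    (hXsol : ∀ᵐ ω ∂μ, IsLinearODESolution (fun s => mulVecCLM (a (α s ω))) (fun s => f s ω) x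
      fun t => X t ω) :
    MemLp (Function.uncurry X) 2 (timeMeasure.prod μ) := by
  obtain ⟨c, hc0, C, hC, hdrift⟩ := exists_quadraticDrift_affine_le hLyapunov
  have hf2 := (memLp_two_iff_integrable_sq_norm hfL.1).1 hfL
  have hXL := hc.memLp_two_Iic_of_isLinearODESolution hfL hX hXsol
  refine memLp_two_of_forall_integral_sq_norm_Iic_le
    (K := (x ⬝ᵥ P i *ᵥ x + C * ∫ z, ‖Function.uncurry f z‖ ^ 2 ∂timeMeasure.prod μ) / c)
    (stronglyMeasurable_uncurry_of_isStronglyProgressive hX).aestronglyMeasurable hXL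
    fun T => ?_
  have restrict_le : (timeMeasure.restrict (Set.Iic T)).prod μ ≤ timeMeasure.prod μ :=
    Measure.prod_mono Measure.restrict_le_self le_rfl
  set ν := (timeMeasure.restrict (Set.Iic T)).prod μ
  have hX2 := ((memLp_two_iff_integrable_sq_norm (hXL T).1).1 (hXL T)).const_mul (-c)
  have hf2T := (hf2.mono_measure restrict_le).const_mul C
  obtain ⟨drift_integrable, energy⟩ :=
    hc.integral_dotProduct_mulVec_eq_of_isLinearODESolution P hf hfL hX hXsol T
  have energy_nonneg : 0 ≤ ∫ ω, X T ω ⬝ᵥ P (α T ω) *ᵥ X T ω ∂μ :=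
    integral_nonneg fun ω => by
      simpa using (hP (α T ω)).posSemidef.dotProduct_mulVec_nonneg (X T ω)
  have dissipation := integral_mono drift_integrable (hX2.add hf2T)
    fun z => hdrift (α z.1 z.2) (X z.1 z.2) (f z.1 z.2)
  simp only [Pi.add_apply] at dissipation
  rw [integral_add hX2 hf2T, integral_const_mul, integral_const_mul] at dissipation
  have forcing := mul_le_mul_of_nonneg_left
    (integral_mono_measure restrict_le (ae_of_all _ fun _ => sq_nonneg _) hf2) hC
  rw [le_div_iff₀ hc0]
  linarith

end Lyapunov

end IsMarkovChainFrom

end Stability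

section SquareIntegrable

variable {Ω : Type*} [mΩ : MeasurableSpace Ω] {k : ℕ} {𝔽 : Filtration ℝ≥0 mΩ} {μ : Measure Ω}
  {u v : ℝ≥0 → Ω → Fin k → ℝ}

lemma mem_L2P_of_ae_eq (hu : u ∈ L2P 𝔽 μ)
    (h : Function.uncurry v =ᵐ[timeMeasure.prod μ] Function.uncurry u) : v ∈ L2P 𝔽 μ :=
  ⟨hu.1.ae_eq h.symm, hu.2.imp fun _ hψ => ⟨hψ.1, h.trans hψ.2⟩⟩

lemma add_mem_L2P (hu : u ∈ L2P 𝔽 μ) (hv : v ∈ L2P 𝔽 μ) : u + v ∈ L2P 𝔽 μ := by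
  obtain ⟨huL, u', hu', hue⟩ := hu
  obtain ⟨hvL, v', hv', hve⟩ := hv
  exact ⟨huL.add hvL, u' + v', hu'.add hv', hue.add hve⟩

lemma sub_mem_L2P (hu : u ∈ L2P 𝔽 μ) (hv : v ∈ L2P 𝔽 μ) : u - v ∈ L2P 𝔽 μ := by
  obtain ⟨huL, u', hu', hue⟩ := hu
  obtain ⟨hvL, v', hv', hve⟩ := hv
  exact ⟨huL.sub hvL, u' - v', hu'.sub hv', hue.sub hve⟩

end SquareIntegrable

lemma forall_eq_add_setIntegral_Iic_congr {E : Type*} [NormedAddCommGroup E] [NormedSpace ℝ E]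
    {g g' Y : ℝ≥0 → E} (h : g =ᵐ[timeMeasure] g') (x : E) :
    (∀ t, Y t = x + ∫ s in Set.Iic t, g s ∂timeMeasure) ↔
      ∀ t, Y t = x + ∫ s in Set.Iic t, g' s ∂timeMeasure :=
  forall_congr' fun _ => by rw [integral_congr_ae (ae_restrict_of_ae h)]

namespace LQData

section RunningCost

variable {D n m : ℕ} {Ω : Type*} {α : ℝ≥0 → Ω → Fin D} {L : LQData D n m Ω}

/-- The integrand of `LQData.cost` at time `t` and scenario `ω`, for the state value `y` and the
control value `w`. -/
noncomputable def runningCost (L : LQData D n m Ω) (α : ℝ≥0 → Ω → Fin D) (t : ℝ≥0) (ω : Ω)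
    (y : Fin n → ℝ) (w : Fin m → ℝ) : ℝ :=
  (Matrix.fromBlocks (L.Q (α t ω)) (L.S (α t ω))ᵀ (L.S (α t ω)) (L.R (α t ω)) *ᵥ Sum.elim y w) ⬝ᵥ
    Sum.elim y w + 2 * (Sum.elim (L.q t ω) (L.ρ t ω) ⬝ᵥ Sum.elim y w)

lemma runningCost_transform {Θ : Fin D → Matrix (Fin m) (Fin n) ℝ} {t : ℝ≥0} {ω : Ω}
    (hR : (L.R (α t ω)).IsSymm) (y : Fin n → ℝ) (w : Fin m → ℝ) :
    (L.transform α Θ).runningCost α t ω y w = L.runningCost α t ω y (Θ (α t ω) *ᵥ y + w) := by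
  have cross : (L.R (α t ω) *ᵥ w) ⬝ᵥ (Θ (α t ω) *ᵥ y) =
      (L.R (α t ω) *ᵥ (Θ (α t ω) *ᵥ y)) ⬝ᵥ w := by
    rw [← transpose_mulVec_dotProduct, hR]
  simp only [runningCost, transform, Matrix.fromBlocks_mulVec, sumElim_dotProduct_sumElim,
    Sum.elim_comp_inl, Sum.elim_comp_inr, Matrix.add_mulVec, Matrix.mulVec_add,
    add_dotProduct, dotProduct_add, transpose_mulVec_dotProduct, ← Matrix.mulVec_mulVec, cross]
  rw [dotProduct_comm (L.S (α t ω) *ᵥ y) (Θ (α t ω) *ᵥ y),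
    dotProduct_comm (L.ρ t ω) (Θ (α t ω) *ᵥ y),
    dotProduct_comm (Θ (α t ω) *ᵥ y) (L.R (α t ω) *ᵥ Θ (α t ω) *ᵥ y)]
  ring

lemma cost_eq_integral_runningCost [mΩ : MeasurableSpace Ω] (𝔽 : Filtration ℝ≥0 mΩ)
    (μ : Measure Ω) (x : Fin n → ℝ) (u : ℝ≥0 → Ω → Fin m → ℝ) : L.cost α 𝔽 μ x u =
    ∫ ω, ∫ t, L.runningCost α t ω (L.state α 𝔽 μ x u t ω) (u t ω) ∂timeMeasure ∂μ :=
  rfl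

end RunningCost

variable {D n m : ℕ} {Ω : Type*} [mΩ : MeasurableSpace Ω] {G : Matrix (Fin D) (Fin D) ℝ}
  {α : ℝ≥0 → Ω → Fin D} {hα : ∀ t, Measurable (α t)} {μ : Measure Ω} {i : Fin D}
  {L : LQData D n m Ω} {Θ : Fin D → Matrix (Fin m) (Fin n) ℝ} {x : Fin n → ℝ}
  {u v : ℝ≥0 → Ω → Fin m → ℝ} {X Y : ℝ≥0 → Ω → Fin n → ℝ}

section StateEquation

variable [SFinite μ]

lemma exists_isState_iff_isLinearODESolution (hc : IsMarkovChainFrom G α hα μ i)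
    (hb : L.b ∈ L2F (augFiltration α hα μ) μ) (hu : u ∈ L2P (augFiltration α hα μ) μ) :
    ∃ f : ℝ≥0 → Ω → Fin n → ℝ, IsStronglyProgressive (augFiltration α hα μ) f ∧
      MemLp (Function.uncurry f) 2 (timeMeasure.prod μ) ∧
      ∀ x X, L.IsState α (augFiltration α hα μ) μ x u X ↔
        IsStronglyProgressive (augFiltration α hα μ) X ∧
          ∀ᵐ ω ∂μ, IsLinearODESolution (fun s => mulVecCLM (L.A (α s ω))) (fun s => f s ω) x
            fun t => X t ω := by
  obtain ⟨huL, u', hu', hue⟩ := hu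
  obtain ⟨hbL, b', hb', hbe⟩ := hb
  refine ⟨fun s ω => mulVecCLM (L.B (α s ω)) (u' s ω) + b' s ω,
    (isStronglyProgressive_clm_apply (hc.isStronglyProgressive_comp fun j => mulVecCLM (L.B j))
      hu'.isStronglyProgressive).add hb',
    (hc.memLp_clm_apply (fun j => mulVecCLM (L.B j)) (huL.ae_eq hue)).add (hbL.ae_eq hbe),
    fun x X => and_congr_right fun _ => eventually_congr ?_⟩
  filter_upwards [ae_ae_swap_of_ae_prod hue, ae_ae_swap_of_ae_prod hbe] with ω huω hbω
  have drift_eq : (fun s => L.A (α s ω) *ᵥ X s ω + L.B (α s ω) *ᵥ u s ω + L.b s ω)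
      =ᵐ[timeMeasure] fun s => mulVecCLM (L.A (α s ω)) (X s ω) +
        (mulVecCLM (L.B (α s ω)) (u' s ω) + b' s ω) := by
    filter_upwards [huω, hbω] with s hus hbs
    simp only [Function.uncurry_apply_pair] at hus hbs
    rw [hus, hbs, add_assoc, mulVecCLM_apply, mulVecCLM_apply]
  rw [forall_eq_add_setIntegral_Iic_congr drift_eq]
  exact ⟨fun h => ⟨h.1, h.2⟩, fun h => ⟨h.continuous, h.eq_add_integral⟩⟩

lemma isState_state (hc : IsMarkovChainFrom G α hα μ i)
    (hb : L.b ∈ L2F (augFiltration α hα μ) μ) (hu : u ∈ L2P (augFiltration α hα μ) μ)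
    (x : Fin n → ℝ) : L.IsState α (augFiltration α hα μ) μ x u
      (L.state α (augFiltration α hα μ) μ x u) := by
  obtain ⟨f, hf, hfL, isState_iff⟩ := exists_isState_iff_isLinearODESolution hc hb hu
  obtain ⟨C, hC⟩ := Finite.exists_le fun j => ‖mulVecCLM (L.A j)‖
  obtain ⟨X, hX⟩ := exists_isStronglyProgressive_isLinearODESolution
    (fun N hN h0 => measurableSet_augFiltration_of_null α hα μ hN h0 0)
    (hc.isStronglyProgressive_comp fun j => mulVecCLM (L.A j)) (fun s ω => hC (α s ω)) hf
    ((ae_memLp_two_path hfL).mono fun ω hω => hω.locallyIntegrable one_le_two) x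
  exact Classical.epsilon_spec (p := L.IsState α (augFiltration α hα μ) μ x u)
    ⟨X, (isState_iff x X).2 hX⟩

lemma IsState.unique (hX : L.IsState α (augFiltration α hα μ) μ x u X)
    (hY : L.IsState α (augFiltration α hα μ) μ x u Y) (hc : IsMarkovChainFrom G α hα μ i)
    (hb : L.b ∈ L2F (augFiltration α hα μ) μ) (hu : u ∈ L2P (augFiltration α hα μ) μ) :
    ∀ᵐ ω ∂μ, ∀ t, X t ω = Y t ω := by
  obtain ⟨f, -, hfL, isState_iff⟩ := exists_isState_iff_isLinearODESolution hc hb hu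
  obtain ⟨C, hC⟩ := Finite.exists_le fun j => ‖mulVecCLM (L.A j)‖
  filter_upwards [((isState_iff x X).1 hX).2, ((isState_iff x Y).1 hY).2, ae_memLp_two_path hfL]
    with ω hXω hYω hfω
  exact congrFun (hXω.unique hYω
    (stronglyMeasurable_path (hc.isStronglyProgressive_comp fun j => mulVecCLM (L.A j)) ω)
    (fun s => hC (α s ω)) (hfω.locallyIntegrable one_le_two))

lemma isState_transform_iff {𝔽 : Filtration ℝ≥0 mΩ}
    (huv : Function.uncurry u =ᵐ[timeMeasure.prod μ]
      Function.uncurry fun t ω => Θ (α t ω) *ᵥ X t ω + v t ω) :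
    (L.transform α Θ).IsState α 𝔽 μ x v X ↔ L.IsState α 𝔽 μ x u X := by
  refine and_congr_right fun _ => eventually_congr ?_
  filter_upwards [ae_ae_swap_of_ae_prod huv] with ω hω
  refine and_congr_right fun _ => forall_eq_add_setIntegral_Iic_congr ?_ x
  filter_upwards [hω] with s hs
  simp only [Function.uncurry_apply_pair] at hs
  simp only [hs, transform, Matrix.add_mulVec, Matrix.mulVec_add, Matrix.mulVec_mulVec]
  abel

lemma IsState.gain_mem_L2P (hX : L.IsState α (augFiltration α hα μ) μ x u X)
    (hc : IsMarkovChainFrom G α hα μ i)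
    (hXL : MemLp (Function.uncurry X) 2 (timeMeasure.prod μ))
    (Θ : Fin D → Matrix (Fin m) (Fin n) ℝ) :
    (fun t ω => Θ (α t ω) *ᵥ X t ω) ∈ L2P (augFiltration α hα μ) μ :=
  ⟨hc.memLp_clm_apply (fun j => mulVecCLM (Θ j)) hXL,
    hc.exists_isStronglyPredictable_apply_ae_eq (fun j => mulVecCLM (Θ j)) hX.1
      (hX.2.mono fun _ h => h.1)⟩

lemma exists_ae_eq_feedback_of_mem_admissible (hc : IsMarkovChainFrom G α hα μ i)
    (hb : L.b ∈ L2F (augFiltration α hα μ) μ) (Θ : Fin D → Matrix (Fin m) (Fin n) ℝ)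
    (hu : u ∈ L.admissible α (augFiltration α hα μ) μ x) :
    ∃ v ∈ L2P (augFiltration α hα μ) μ, Function.uncurry u =ᵐ[timeMeasure.prod μ]
      Function.uncurry (L.feedback α (augFiltration α hα μ) μ Θ x v) := by
  obtain ⟨huP, hXF⟩ := hu
  have hX := isState_state hc hb huP x
  set X := L.state α (augFiltration α hα μ) μ x u
  set v : ℝ≥0 → Ω → Fin m → ℝ := u - fun t ω => Θ (α t ω) *ᵥ X t ω
  have hv : v ∈ L2P (augFiltration α hα μ) μ := sub_mem_L2P huP (hX.gain_mem_L2P hc hXF.1 Θ)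
  have u_eq (t : ℝ≥0) (ω : Ω) : u t ω = Θ (α t ω) *ᵥ X t ω + v t ω := by simp [v]
  have hXv : (L.transform α Θ).IsState α (augFiltration α hα μ) μ x v X :=
    (isState_transform_iff (ae_of_all _ fun z => u_eq z.1 z.2)).2 hX
  have state_eq := (isState_state (L := L.transform α Θ) hc hb hv x).unique hXv hc hb hv
  refine ⟨v, hv, ?_⟩
  filter_upwards [Measure.quasiMeasurePreserving_snd.ae state_eq] with z hz
  simp only [Function.uncurry_def, feedback, hz z.1, u_eq]

end StateEquation

section Feedback

variable [IsProbabilityMeasure μ]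

lemma memLp_two_of_isState_transform (hc : IsMarkovChainFrom G α hα μ i)
    (hΘ : Θ ∈ L.stabilizers G) (hb : L.b ∈ L2F (augFiltration α hα μ) μ)
    (hv : v ∈ L2P (augFiltration α hα μ) μ)
    (hX : (L.transform α Θ).IsState α (augFiltration α hα μ) μ x v X) :
    MemLp (Function.uncurry X) 2 (timeMeasure.prod μ) := by
  obtain ⟨P, hP, hLyapunov⟩ := hΘ
  obtain ⟨f, hf, hfL, isState_iff⟩ :=
    exists_isState_iff_isLinearODESolution (L := L.transform α Θ) hc hb hv
  exact hc.memLp_two_of_lyapunov hP hLyapunov hf hfL hX.1 ((isState_iff x X).1 hX).2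

lemma mem_L2P_of_ae_eq_feedback (hc : IsMarkovChainFrom G α hα μ i) (hΘ : Θ ∈ L.stabilizers G)
    (hb : L.b ∈ L2F (augFiltration α hα μ) μ) (hv : v ∈ L2P (augFiltration α hα μ) μ)
    (huv : Function.uncurry u =ᵐ[timeMeasure.prod μ]
      Function.uncurry (L.feedback α (augFiltration α hα μ) μ Θ x v)) :
    u ∈ L2P (augFiltration α hα μ) μ :=
  have hX := isState_state (L := L.transform α Θ) hc hb hv x
  mem_L2P_of_ae_eq
    (add_mem_L2P (hX.gain_mem_L2P hc (memLp_two_of_isState_transform hc hΘ hb hv hX) Θ) hv) huv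

lemma state_eq_state_transform_of_ae_eq_feedback (hc : IsMarkovChainFrom G α hα μ i)
    (hΘ : Θ ∈ L.stabilizers G) (hb : L.b ∈ L2F (augFiltration α hα μ) μ)
    (hv : v ∈ L2P (augFiltration α hα μ) μ)
    (huv : Function.uncurry u =ᵐ[timeMeasure.prod μ]
      Function.uncurry (L.feedback α (augFiltration α hα μ) μ Θ x v)) :
    ∀ᵐ ω ∂μ, ∀ t, L.state α (augFiltration α hα μ) μ x u t ω =
      (L.transform α Θ).state α (augFiltration α hα μ) μ x v t ω :=
  have hu := mem_L2P_of_ae_eq_feedback hc hΘ hb hv huv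
  (isState_state hc hb hu x).unique
    ((isState_transform_iff huv).1 (isState_state (L := L.transform α Θ) hc hb hv x)) hc hb hu

lemma mem_admissible_of_ae_eq_feedback (hc : IsMarkovChainFrom G α hα μ i)
    (hΘ : Θ ∈ L.stabilizers G) (hb : L.b ∈ L2F (augFiltration α hα μ) μ)
    (hv : v ∈ L2P (augFiltration α hα μ) μ)
    (huv : Function.uncurry u =ᵐ[timeMeasure.prod μ]
      Function.uncurry (L.feedback α (augFiltration α hα μ) μ Θ x v)) :
    u ∈ L.admissible α (augFiltration α hα μ) μ x := by
  have hX := isState_state (L := L.transform α Θ) hc hb hv x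
  have state_ae_eq : Function.uncurry (L.state α (augFiltration α hα μ) μ x u)
      =ᵐ[timeMeasure.prod μ]
        Function.uncurry ((L.transform α Θ).state α (augFiltration α hα μ) μ x v) :=
    (Measure.quasiMeasurePreserving_snd.ae
      (state_eq_state_transform_of_ae_eq_feedback hc hΘ hb hv huv)).mono fun z hz => hz z.1
  exact ⟨mem_L2P_of_ae_eq_feedback hc hΘ hb hv huv,
    (memLp_two_of_isState_transform hc hΘ hb hv hX).ae_eq state_ae_eq.symm, _, hX.1, state_ae_eq⟩

lemma cost_transform_eq_of_ae_eq_feedback (hc : IsMarkovChainFrom G α hα μ i)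
    (hR : ∀ j, (L.R j).IsSymm) (hΘ : Θ ∈ L.stabilizers G)
    (hb : L.b ∈ L2F (augFiltration α hα μ) μ) (hv : v ∈ L2P (augFiltration α hα μ) μ)
    (huv : Function.uncurry u =ᵐ[timeMeasure.prod μ]
      Function.uncurry (L.feedback α (augFiltration α hα μ) μ Θ x v)) :
    (L.transform α Θ).cost α (augFiltration α hα μ) μ x v =
      L.cost α (augFiltration α hα μ) μ x u := by
  simp only [cost_eq_integral_runningCost, runningCost_transform (hR _)]
  refine integral_congr_ae ?_
  filter_upwards [state_eq_state_transform_of_ae_eq_feedback hc hΘ hb hv huv,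
    ae_ae_swap_of_ae_prod huv] with ω state_eq huω
  refine integral_congr_ae ?_
  filter_upwards [huω] with t hut
  simp only [Function.uncurry_apply_pair, feedback] at hut
  rw [state_eq, hut]

lemma admissible_eq_setOf_ae_eq_feedback (hc : IsMarkovChainFrom G α hα μ i)
    (hΘ : Θ ∈ L.stabilizers G) (hb : L.b ∈ L2F (augFiltration α hα μ) μ) (x : Fin n → ℝ) :
    L.admissible α (augFiltration α hα μ) μ x =
      {u | ∃ v ∈ L2P (augFiltration α hα μ) μ, Function.uncurry u =ᵐ[timeMeasure.prod μ]
        Function.uncurry (L.feedback α (augFiltration α hα μ) μ Θ x v)} :=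
  Set.Subset.antisymm (fun _ => exists_ae_eq_feedback_of_mem_admissible hc hb Θ)
    fun _ ⟨_, hv, huv⟩ => mem_admissible_of_ae_eq_feedback hc hΘ hb hv huv

end Feedback

end LQData

end MarkovLQ

theorem mainTheorem8_general {D n m : ℕ} {Ω : Type*} [mΩ : MeasurableSpace Ω]
    (G : Matrix (Fin D) (Fin D) ℝ) (α : ℝ≥0 → Ω → Fin D) (hα : ∀ t, Measurable (α t))
    (P : Fin D → Measure Ω) [∀ i, IsProbabilityMeasure (P i)]
    (hchain : ∀ i, MarkovLQ.IsMarkovChainFrom G α hα (P i) i)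
    (L : MarkovLQ.LQData D n m Ω) (hR : ∀ i, (L.R i).IsSymm)
    (hb : ∀ i, L.b ∈ MarkovLQ.L2F (MarkovLQ.augFiltration α hα (P i)) (P i))
    (hq : ∀ i, L.q ∈ MarkovLQ.L2F (MarkovLQ.augFiltration α hα (P i)) (P i))
    (hρ : ∀ i, L.ρ ∈ MarkovLQ.L2F (MarkovLQ.augFiltration α hα (P i)) (P i))
    (Θ : Fin D → Matrix (Fin m) (Fin n) ℝ) (hΘ : Θ ∈ L.stabilizers G)
    (ν : ℝ≥0 → Ω → Fin m → ℝ)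
    (hν : ∀ i, ν ∈ MarkovLQ.L2P (MarkovLQ.augFiltration α hα (P i)) (P i)) :
    (∀ (x : Fin n → ℝ) (i : Fin D),
      ∀ v ∈ MarkovLQ.L2P (MarkovLQ.augFiltration α hα (P i)) (P i),
        (L.transform α Θ).cost α (MarkovLQ.augFiltration α hα (P i)) (P i) x v =
          L.cost α (MarkovLQ.augFiltration α hα (P i)) (P i) x
            (L.feedback α (MarkovLQ.augFiltration α hα (P i)) (P i) Θ x v)) ∧
    (∀ (x : Fin n → ℝ) (i : Fin D),
      L.admissible α (MarkovLQ.augFiltration α hα (P i)) (P i) x =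
        {u | ∃ v ∈ MarkovLQ.L2P (MarkovLQ.augFiltration α hα (P i)) (P i),
          Function.uncurry u =ᵐ[MarkovLQ.timeMeasure.prod (P i)] Function.uncurry
            (L.feedback α (MarkovLQ.augFiltration α hα (P i)) (P i) Θ x v)}) ∧
    (L.IsClosedLoopOptimal G α hα P Θ ν ↔
      ∀ (x : Fin n → ℝ) (i : Fin D), L.IsOpenLoopOptimalTransformed α hα P Θ x i ν) := by
  have cost_eq (x i v) (hv : v ∈ MarkovLQ.L2P (MarkovLQ.augFiltration α hα (P i)) (P i)) u :=
    MarkovLQ.LQData.cost_transform_eq_of_ae_eq_feedback (x := x) (u := u) (hchain i) hR hΘ (hb i) hv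
  have feedback_cost x i v hv := cost_eq x i v hv _ (ae_eq_refl _)
  have admissible_eq x i :=
    MarkovLQ.LQData.admissible_eq_setOf_ae_eq_feedback (hchain i) hΘ (hb i) x
  refine ⟨feedback_cost, fun x i => admissible_eq x i,
    fun closedLoop x i => ⟨hν i, isMinOn_iff.2 fun v hv => ?_⟩,
    fun openLoop => ⟨hΘ, hν, fun x i u hu => ?_⟩⟩
  · rw [feedback_cost x i ν (hν i), feedback_cost x i v hv]
    refine closedLoop.2.2 x i _ ?_
    rw [admissible_eq]
    exact ⟨v, hv, ae_eq_refl _⟩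
  · rw [admissible_eq] at hu
    obtain ⟨v, hv, huv⟩ := hu
    rw [← feedback_cost x i ν (hν i), ← cost_eq x i v hv u huv]
    exact isMinOn_iff.1 (openLoop x i).2 v hv

theorem mainTheorem8 {D n m : ℕ} {Ω : Type*} [mΩ : MeasurableSpace Ω]
    -- the Markov chain, with `P i` the law under which it starts at `i`
    (G : Matrix (Fin D) (Fin D) ℝ) (hG : MarkovLQ.IsIrreducibleGenerator G)
    (α : ℝ≥0 → Ω → Fin D) (hα : ∀ t, Measurable (α t))
    (P : Fin D → Measure Ω) [∀ i, IsProbabilityMeasure (P i)]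
    (hchain : ∀ i, MarkovLQ.IsMarkovChainFrom G α hα (P i) i)
    -- the coefficients
    (L : MarkovLQ.LQData D n m Ω) (hL : L.WeightsOK)
    (hb : ∀ i, L.b ∈ MarkovLQ.L2F (MarkovLQ.augFiltration α hα (P i)) (P i))
    (hq : ∀ i, L.q ∈ MarkovLQ.L2F (MarkovLQ.augFiltration α hα (P i)) (P i))
    (hρ : ∀ i, L.ρ ∈ MarkovLQ.L2F (MarkovLQ.augFiltration α hα (P i)) (P i))
    -- stabilizability
    (hH1 : (L.stabilizers G).Nonempty)
    -- the pair
    (Θ : Fin D → Matrix (Fin m) (Fin n) ℝ) (hΘ : Θ ∈ L.stabilizers G)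
    (ν : ℝ≥0 → Ω → Fin m → ℝ)
    (hν : ∀ i, ν ∈ MarkovLQ.L2P (MarkovLQ.augFiltration α hα (P i)) (P i)) :
    -- the transformed cost is the cost of the feedback control
    (∀ (x : Fin n → ℝ) (i : Fin D),
      ∀ v ∈ MarkovLQ.L2P (MarkovLQ.augFiltration α hα (P i)) (P i),
        (L.transform α Θ).cost α (MarkovLQ.augFiltration α hα (P i)) (P i) x v =
          L.cost α (MarkovLQ.augFiltration α hα (P i)) (P i) x
            (L.feedback α (MarkovLQ.augFiltration α hα (P i)) (P i) Θ x v)) ∧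
    -- the admissible controls are exactly the feedback controls (up to `dt ⊗ dP i`-null sets)
    (∀ (x : Fin n → ℝ) (i : Fin D),
      L.admissible α (MarkovLQ.augFiltration α hα (P i)) (P i) x =
        {u | ∃ v ∈ MarkovLQ.L2P (MarkovLQ.augFiltration α hα (P i)) (P i),
          Function.uncurry u =ᵐ[MarkovLQ.timeMeasure.prod (P i)] Function.uncurry
            (L.feedback α (MarkovLQ.augFiltration α hα (P i)) (P i) Θ x v)}) ∧
    -- the characterization
    (L.IsClosedLoopOptimal G α hα P Θ ν ↔
      ∀ (x : Fin n → ℝ) (i : Fin D), L.IsOpenLoopOptimalTransformed α hα P Θ x i ν) :=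
  mainTheorem8_general G α hα P hchain L
    (fun i => Matrix.isHermitian_iff_isSymm.1 (hL.R_pos i).isHermitian) hb hq hρ Θ hΘ ν hν
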